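/- **Conventions.** Let $\sigma(x)_k=x_{k+1}$ be the shift on $\{0,\dots,n-1\}^{\mathbb Z}$. A shift space $X\subseteq\{0,\dots,n-1\}^{\mathbb Z}$ (a set with $\sigma X\subseteq X$) carries the product topology and the metric $d(x,y)=\sum_{k\in\mathbb Z}|x_k-y_k|\,n^{-|k|-1}$; $\dim X$ is its Hausdorff dimension for $d$. Its topological entropy is $h(X)=\lim_k\frac1k\log\Gamma_k(X)$, where $\Gamma_k(X)$ is the number of words of length $k$ occurring in $X$; the entropy of a $\sigma$-invariant Borel probability measure $\mu$ on $X$ is $h_\mu(X)=-\lim_k\frac1k\sum_I\mu(I)\log\mu(I)$, the sum over the cylinders of length $k$; $\mathcal M_{\max}(X)$, with the weak topology, is the set of such $\mu$ with $h_\mu(X)=h(X)$. A factor map $f$ is a continuous shift-commuting surjection, $f\mu=\mu\circ f^{-1}$; it is finite-to-one if every point has finitely many preimages, uniform if $f\mu\in\mathcal M_{\max}(Y)$ for every $\mu\in\mathcal M_{\max}(X)$, and a factor map $f:X\to Y$ has a synchronizing word if there are a nonempty word $w_0\cdots w_k$ of $Y$ and a symbol $a$ such that $x_k=a$ for all $x\in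 X$ with $f(x)_0\cdots f(x)_k=w_0\cdots w_k$. Let $\mathcal B$ be a set of local patterns in $\{-1,1\}^{(2d+1)\times 2}$, for instance the basic set of admissible local patterns of a two-layer cellular neural network. The solution space $\mathbf Y$ is the set of pairs $(y^{(1)},y^{(2)})$ of sequences in $\{-1,1\}^{\mathbb Z}$ whose restriction to $\{k-d,\dots,k+d\}$ belongs to $\mathcal B$ for every $k\in\mathbb Z$, and the hidden space $\mathbf Y^{(1)}$ and the output space $\mathbf Y^{(2)}$ are the projections of $\mathbf Y$ to $y^{(1)}$ and $y^{(2)}$. In the metric the symbols $-1,1$ are coded as $0,1$, and $n_1=n_2=2$ is the number of symbols. For $i=1,2$ let $W^{(i)}=\{x: T^{(i)}(x_k,x_{k+1})=1\ \forall k\in\mathbb Z\}$ be the topological Markov chain of an irreducible $0$-$1$ matrix $T^{(i)}$ of size $m_i\ge1$, and let $\phi^{(i)}:W^{(i)}\to\mathbf Y^{(i)}$ be a finite-to-one factor map. For a shift space $X$ over $n$ symbols, $\kappa>0$ and an invariant probability measure $\mu$ on $X$, let $D_\kappa(X,\mu)$ be the formula $$\dim X=\kappa\,\frac{h_\mu(X)}{\log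 n}\qquad(\text{with } 0/0=0 \text{ if } n=1).$$ **Theorem.** Assume $h(\mathbf Y^{(1)})\ne h(\mathbf Y^{(2)})$, and let $\{i,\bar\imath\}=\{1,2\}$. (i) If $\pi:W^{(i)}\to W^{(\bar\imath)}$ is a uniform factor map, $\mu^{(i)}\in\mathcal M_{\max}(W^{(i)})$, $\mu^{(\bar\imath)}\in\mathcal M_{\max}(W^{(\bar\imath)})$ and $\kappa>0$, then $D_\kappa(W^{(i)},\mu^{(i)})$ implies $$\dim W^{(\bar\imath)}=\kappa\,\frac{h_{\mu^{(\bar\imath)}}(W^{(\bar\imath)})}{\log m_{\bar\imath}}=\kappa\,\frac{h_{\pi\mu^{(i)}}(W^{(\bar\imath)})}{\log m_{\bar\imath}} .$$ Suppose moreover that $h(\mathbf Y^{(i)})>h(\mathbf Y^{(\bar\imath)})$ and that $\phi^{(i)}$ has a synchronizing word. Then there is a map $\bar\pi:\mathcal M_{\max}(\mathbf Y^{(i)})\to\mathcal M_{\max}(\mathbf Y^{(\bar\imath)})$ such that: (ii) $\bar\pi$ is continuous and onto, and for every uniform factor map $\pi:W^{(i)}\to W^{(\bar\imath)}$ and every $\mu\in\mathcal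 M_{\max}(W^{(i)})$ one has $\phi^{(i)}\mu\in\mathcal M_{\max}(\mathbf Y^{(i)})$ and $\bar\pi(\phi^{(i)}\mu)=\phi^{(\bar\imath)}(\pi\mu)$; (iii) for every $\nu^{(i)}\in\mathcal M_{\max}(\mathbf Y^{(i)})$ and every $\kappa>0$, if $$\dim\mathbf Y^{(i)}=\kappa\,\frac{h_{\nu^{(i)}}(\mathbf Y^{(i)})}{\log n_i},\quad\text{then}\quad \dim\mathbf Y^{(\bar\imath)}=\kappa\,\frac{h_{\bar\pi\nu^{(i)}}(\mathbf Y^{(\bar\imath)})}{\log n_{\bar\imath}} .$$ -/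

import Mathlib

open MeasureTheory Filter Topology

noncomputable section

/-- The shift map `σ(x)ᵢ = xᵢ₊₁` on the full shift with alphabet `{0, …, n - 1}`. -/
def shift {n : ℕ} (x : ℤ → Fin n) : ℤ → Fin n := fun i => x (i + 1)

/-- A shift space over the alphabet `{0, …, n - 1}`: a shift-invariant set of bi-infinite
sequences. The full shift carries the product topology and its Borel σ-algebra, and a shift
space carries the induced ones. -/
structure ShiftSpace (n : ℕ) where
  carrier : Set (ℤ → Fin n)
  shift_mem : ∀ x ∈ carrier, shift x ∈ carrier

namespace ShiftSpace

variable {m n : ℕ}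

/-- The points of a shift space. -/
abbrev Pt (X : ShiftSpace n) : Type := X.carrier

/-- The shift map of a shift space. -/
def shiftMap (X : ShiftSpace n) (x : X.Pt) : X.Pt := ⟨shift x.1, X.shift_mem x.1 x.2⟩

/-- The words of length `k` that occur in `X`. -/
def words (X : ShiftSpace n) (k : ℕ) : Set (Fin k → Fin n) :=
  {w | ∃ x ∈ X.carrier, ∃ i : ℤ, ∀ l : Fin k, x (i + (l : ℕ)) = w l}

/-- Topological entropy, the growth rate of the number of words
(the sequence converges, by subadditivity, so the upper limit is the limit). -/
def entropy (X : ShiftSpace n) : ℝ :=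
  limsup (fun k : ℕ => Real.log ((X.words k).ncard : ℝ) / k) atTop

/-- The cylinder of the points of `X` that carry the word `w` at the coordinates `0, …, k - 1`. -/
def cylinder (X : ShiftSpace n) {k : ℕ} (w : Fin k → Fin n) : Set X.Pt :=
  {x | ∀ l : Fin k, x.1 ((l : ℕ) : ℤ) = w l}

/-- Measure-theoretic entropy `-lim (1/k) ∑ μ(I) log μ(I)`, the sum over the cylinders of
length `k` (for an invariant measure the sequence converges, by subadditivity). -/
def measureEntropy (X : ShiftSpace n) (μ : ProbabilityMeasure X.Pt) : ℝ :=
  limsup (fun k : ℕ =>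
    (∑ w : Fin k → Fin n, Real.negMulLog ((μ : Measure X.Pt).real (X.cylinder w))) / k) atTop

/-- The set of measures of maximal entropy: shift-invariant Borel probability measures on `X`
whose entropy is the topological entropy of `X`. -/
def maxMeasures (X : ShiftSpace n) : Set (ProbabilityMeasure X.Pt) :=
  {μ | MeasurePreserving X.shiftMap (μ : Measure X.Pt) (μ : Measure X.Pt) ∧
    X.measureEntropy μ = X.entropy}

/-- The metric `d(x, y) = ∑ᵢ |xᵢ - yᵢ| / n ^ (|i| + 1)` on the full shift over `n` symbols. -/
@[reducible] def fullShiftMetric (n : ℕ) : EMetricSpace (ℤ → Fin n) where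
  edist x y := ∑' i : ℤ,
    ENNReal.ofReal (|((x i : ℕ) : ℝ) - ((y i : ℕ) : ℝ)| / (n : ℝ) ^ (i.natAbs + 1))
  edist_self x := by simp
  edist_comm x y := by simp only [abs_sub_comm]
  edist_triangle x y z := by
    rw [← ENNReal.tsum_add]
    refine ENNReal.tsum_le_tsum fun i => ?_
    rw [← ENNReal.ofReal_add (by positivity) (by positivity), ← add_div]
    exact ENNReal.ofReal_le_ofReal (by gcongr; exact abs_sub_le _ _ _)
  eq_of_edist_eq_zero := by
    intro x y h
    funext i
    have hi := ENNReal.tsum_eq_zero.1 h i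
    have hn : 0 < (n : ℝ) := by exact_mod_cast (Fin.pos (x i))
    have hp : 0 < (n : ℝ) ^ (i.natAbs + 1) := pow_pos hn _
    rw [ENNReal.ofReal_eq_zero, div_le_iff₀ hp, zero_mul] at hi
    have h0 := abs_nonpos_iff.1 hi
    exact Fin.ext (by exact_mod_cast sub_eq_zero.1 h0)

/-- The Hausdorff dimension of a shift space with respect to `fullShiftMetric`. -/
def dim (X : ShiftSpace n) : ENNReal := @dimH (ℤ → Fin n) (fullShiftMetric n) X.carrier

/-- The formula `dim X = κ * h_μ(X) / log n`, where `n` is the number of symbols. -/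
def DimFormula (X : ShiftSpace n) (κ : ℝ) (μ : ProbabilityMeasure X.Pt) : Prop :=
  X.dim = ENNReal.ofReal (κ * X.measureEntropy μ / Real.log n)

end ShiftSpace

/-- A factor map: a continuous onto map that commutes with the shifts. -/
structure FactorMap {m n : ℕ} (X : ShiftSpace m) (Y : ShiftSpace n) where
  toFun : X.Pt → Y.Pt
  continuous_toFun : Continuous toFun
  surjective_toFun : Function.Surjective toFun
  semiconj : Function.Semiconj toFun X.shiftMap Y.shiftMap

namespace FactorMap

variable {m n : ℕ} {X : ShiftSpace m} {Y : ShiftSpace n}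

/-- The push-forward of a measure under a factor map. -/
def push (f : FactorMap X Y) (μ : ProbabilityMeasure X.Pt) : ProbabilityMeasure Y.Pt :=
  μ.map f.continuous_toFun.measurable.aemeasurable

/-- Every point has finitely many preimages. -/
def FiniteToOne (f : FactorMap X Y) : Prop := ∀ y : Y.Pt, (f.toFun ⁻¹' {y}).Finite

/-- A uniform factor maps measures of maximal entropy to measures of maximal entropy. -/
def IsUniform (f : FactorMap X Y) : Prop := ∀ μ ∈ X.maxMeasures, f.push μ ∈ Y.maxMeasures

/-- A synchronizing word: a nonempty word `w` of `Y` such that all the preimages of `w` have the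
same terminal entry. If `f` is the one-block code of `Φ`, then the preimages of `w`
are the words `u` of `X` with `Φ(u₀) ⋯ Φ(uₖ) = w`. -/
def HasSynchronizingWord (f : FactorMap X Y) : Prop :=
  ∃ (k : ℕ) (w : Fin (k + 1) → Fin n), w ∈ Y.words (k + 1) ∧
    ∃ a : Fin m, ∀ x : X.Pt, f.toFun x ∈ Y.cylinder w → x.1 k = a

end FactorMap

/-- The topological Markov chain of a `0`-`1` transition matrix. -/
def markovChain {m : ℕ} (T : Matrix (Fin m) (Fin m) ℝ) : ShiftSpace m where
  carrier := {x | ∀ i : ℤ, T (x i) (x (i + 1)) = 1}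
  shift_mem _ hx i := hx (i + 1)

/-- The solution space of a two-layer network with basic set `B` of admissible local patterns of
size `(2 * d + 1) × 2`. The layers are numbered by `0` (hidden) and `1` (output), and the symbols
`0`, `1` stand for the states `-1`, `+1`. -/
def solutionSpace (d : ℕ) (B : Set (Fin 2 → Fin (2 * d + 1) → Fin 2)) :
    Set (Fin 2 → ℤ → Fin 2) :=
  {y | ∀ i : ℤ, (fun (l : Fin 2) (k : Fin (2 * d + 1)) => y l (i - d + (k : ℕ))) ∈ B}

/-- The hidden space (`l = 0`) and the output space (`l = 1`): the projections of the
solution space to its two layers. -/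
def layerSpace (d : ℕ) (B : Set (Fin 2 → Fin (2 * d + 1) → Fin 2)) (l : Fin 2) :
    ShiftSpace 2 where
  carrier := {u | ∃ y ∈ solutionSpace d B, y l = u}
  shift_mem := by
    rintro _ ⟨y, hy, rfl⟩
    refine ⟨fun l => shift (y l), fun i => ?_, rfl⟩
    have h := hy (i + 1)
    have e : (fun (l : Fin 2) (k : Fin (2 * d + 1)) => shift (y l) (i - d + (k : ℕ))) =
        fun (l : Fin 2) (k : Fin (2 * d + 1)) => y l (i + 1 - d + (k : ℕ)) := by
      funext l k
      simp only [shift]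
      congr 1
      ring
    rw [e]
    exact h

end

/-!
### Idea of the proof

In all the spaces involved any past can be joined to any future after a gap of bounded length: this
holds for an irreducible Markov chain and passes to factors. Under this property the number of words
of length `k` is `exp (h k)` up to constant factors, and a weak limit of orbit measures spread
evenly over all words is a Gibbs measure: each cylinder of length `k` that occurs has measure
`exp (-h k)` up to constant factors. A Gibbs measure is ergodic, and a set that it neglects carries
too few words to support a measure of maximal entropy, so it is the only such measure.

The cylinders on `{-p, …, p - 1}` have diameter about `n ^ (-p)`, so by the mass distribution
principle the Gibbs bounds give `dim = 2 h / log n`. The dimension formula for a measure of maximal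
entropy thus says that `κ = 2` or `h = 0`, and either condition passes to a space of smaller
entropy.

A finite-to-one factor map of a Markov chain has no diamonds, hence it preserves entropy and maps
the measure of maximal entropy to the one of the image. The map `πbar` is the map between the two
singletons.
-/

/-! ### Shannon entropy -/

section ShannonEntropy

open Real (negMulLog)

variable {Ω ι κ : Type*}

theorem sum_negMulLog_le_of_card_le {s : Finset ι} {M : ℕ} (hM : s.card ≤ M) {p : ι → ℝ}
    (hp : ∀ i ∈ s, 0 ≤ p i) :
    ∑ i ∈ s, negMulLog (p i) ≤ negMulLog (∑ i ∈ s, p i) + (∑ i ∈ s, p i) * Real.log M := by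
  rcases s.eq_empty_or_nonempty with rfl | hs
  · simp
  have hcard : (0 : ℝ) < s.card := by exact_mod_cast hs.card_pos
  have jensen := Real.concaveOn_negMulLog.le_map_sum (t := s) (w := fun _ => (s.card : ℝ)⁻¹)
    (p := p) (fun _ _ => by positivity) (by simp [hcard.ne']) hp
  simp only [smul_eq_mul, ← Finset.mul_sum] at jensen
  rw [mul_comm (s.card : ℝ)⁻¹ (∑ i ∈ s, p i), Real.negMulLog_mul, inv_mul_le_iff₀ hcard] at jensen
  calc ∑ i ∈ s, negMulLog (p i)
      ≤ negMulLog (∑ i ∈ s, p i) + (∑ i ∈ s, p i) * Real.log s.card := by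
        refine jensen.trans_eq ?_
        simp only [negMulLog, Real.log_inv]
        field_simp
    _ ≤ _ := by
        gcongr
        exact Finset.sum_nonneg hp

theorem negMulLog_sum_le {s : Finset ι} {p : ι → ℝ} (hp : ∀ i ∈ s, 0 ≤ p i) :
    negMulLog (∑ i ∈ s, p i) ≤ ∑ i ∈ s, negMulLog (p i) := by
  simp only [negMulLog, neg_mul, Finset.sum_mul, Finset.sum_neg_distrib, neg_le_neg_iff]
  refine Finset.sum_le_sum fun i hi => ?_
  rcases (hp i hi).eq_or_lt with h | h
  · simp [← h]
  · gcongr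
    exact Finset.single_le_sum hp hi

theorem sum_negMulLog_le_add_of_sum_eq_one [Fintype ι] [Fintype κ] {p : ι → κ → ℝ}
    (hp : ∀ i j, 0 ≤ p i j) (hp1 : ∑ j, ∑ i, p i j = 1) :
    ∑ i, ∑ j, negMulLog (p i j) ≤
      ∑ i, negMulLog (∑ j, p i j) + ∑ j, negMulLog (∑ i, p i j) := by
  set q : κ → ℝ := fun j => ∑ i, p i j
  have q_nonneg : ∀ j, 0 ≤ q j := fun j => Finset.sum_nonneg fun i _ => hp i j
  have mul_div_q : ∀ i j, q j * (p i j / q j) = p i j := fun i j =>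
    mul_div_cancel_of_imp' fun h => (Finset.sum_eq_zero_iff_of_nonneg fun i _ => hp i j).1 h i
      (Finset.mem_univ i)
  have jensen : ∀ i, ∑ j, q j * negMulLog (p i j / q j) ≤ negMulLog (∑ j, p i j) := fun i => by
    simpa only [smul_eq_mul, mul_div_q] using
      Real.concaveOn_negMulLog.le_map_sum (t := Finset.univ) (w := q) (p := fun j => p i j / q j)
        (fun j _ => q_nonneg j) hp1 fun j _ => div_nonneg (hp i j) (q_nonneg j)
  have chain_rule : ∀ i j, negMulLog (p i j) =
      q j * negMulLog (p i j / q j) + p i j / q j * negMulLog (q j) := fun i j => by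
    rw [add_comm, ← Real.negMulLog_mul, mul_div_q]
  have sum_cond : ∀ j, ∑ i, p i j / q j * negMulLog (q j) = negMulLog (q j) := fun j => by
    rw [← Finset.sum_mul, ← Finset.sum_div]
    rcases eq_or_ne (q j) 0 with h | h
    · simp [h]
    · rw [div_self h, one_mul]
  simp only [chain_rule, Finset.sum_add_distrib]
  rw [Finset.sum_comm (f := fun i j => p i j / q j * negMulLog (q j))]
  simp only [sum_cond]
  exact add_le_add_left (Finset.sum_le_sum fun i _ => jensen i) _

variable [MeasurableSpace Ω]

/-- The Shannon entropy of a function with finitely many values, viewed as a random variable. -/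
noncomputable def shannonEntropy [Fintype ι] (μ : Measure Ω) (f : Ω → ι) : ℝ :=
  ∑ i, negMulLog (μ.real (f ⁻¹' {i}))

theorem shannonEntropy_equiv [Fintype ι] [Fintype κ] {μ : Measure Ω} {f : Ω → ι} (e : ι ≃ κ) :
    shannonEntropy μ (e ∘ f) = shannonEntropy μ f := by
  simp only [shannonEntropy, ← e.sum_comp, Set.preimage_comp, ← Set.image_singleton,
    e.preimage_image]

theorem shannonEntropy_map [Fintype ι] {Ω' : Type*} [MeasurableSpace Ω'] [MeasurableSpace ι]
    [MeasurableSingletonClass ι] (μ : Measure Ω) {f : Ω → Ω'} (hf : Measurable f) {g : Ω' → ι}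
    (hg : Measurable g) : shannonEntropy (μ.map f) g = shannonEntropy μ (g ∘ f) :=
  Finset.sum_congr rfl fun i _ => congrArg _ <|
    map_measureReal_apply hf (hg (measurableSet_singleton i))

theorem shannonEntropy_nonneg [Fintype ι] {μ : Measure Ω} [IsZeroOrProbabilityMeasure μ]
    {f : Ω → ι} : 0 ≤ shannonEntropy μ f :=
  Finset.sum_nonneg fun _ _ => Real.negMulLog_nonneg measureReal_nonneg measureReal_le_one

theorem shannonEntropy_prodMk [Fintype ι] [Fintype κ] (μ : Measure Ω) (f : Ω → ι) (g : Ω → κ) :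
    shannonEntropy μ (fun x => (f x, g x)) =
      ∑ i, ∑ j, negMulLog (μ.real (f ⁻¹' {i} ∩ g ⁻¹' {j})) := by
  simp only [shannonEntropy, Fintype.sum_prod_type, ← Set.singleton_prod_singleton,
    Set.mk_preimage_prod]

theorem shannonEntropy_eq_sum [Fintype ι] {μ : Measure Ω} {f : Ω → ι} {s : Finset ι}
    (hs : ∀ x, f x ∈ s) : shannonEntropy μ f = ∑ i ∈ s, negMulLog (μ.real (f ⁻¹' {i})) := by
  refine (Finset.sum_subset s.subset_univ fun i _ hi => ?_).symm
  rw [Set.preimage_singleton_eq_empty.2, measureReal_empty, Real.negMulLog_zero]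
  rintro ⟨x, rfl⟩
  exact hi (hs x)

variable [MeasurableSpace ι] [MeasurableSingletonClass ι] {f : Ω → ι} {g : Ω → κ}

theorem sum_measureReal_inter_preimage_singleton [Fintype ι] (μ : Measure Ω) [IsFiniteMeasure μ]
    (hf : Measurable f) (s : Set Ω) : ∑ i, μ.real (s ∩ f ⁻¹' {i}) = μ.real s := by
  have h := sum_measureReal_preimage_singleton (μ := μ.restrict s) Finset.univ
    fun i _ => hf (measurableSet_singleton i)
  simpa [measureReal_restrict_apply (hf (measurableSet_singleton _)), Set.inter_comm] using h

theorem shannonEntropy_le_log_card [Fintype ι] {μ : Measure Ω} [IsProbabilityMeasure μ]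
    (hf : Measurable f) {s : Finset ι} (hs : ∀ x, f x ∈ s) :
    shannonEntropy μ f ≤ Real.log s.card := by
  have total : ∑ i ∈ s, μ.real (f ⁻¹' {i}) = 1 := by
    rw [sum_measureReal_preimage_singleton s fun i _ => hf (measurableSet_singleton i),
      Set.preimage_eq_univ_iff.2 (Set.range_subset_iff.2 hs), probReal_univ]
  have h := sum_negMulLog_le_of_card_le le_rfl (s := s) (p := fun i => μ.real (f ⁻¹' {i}))
    fun _ _ => measureReal_nonneg
  rwa [total, Real.negMulLog_one, zero_add, one_mul, ← shannonEntropy_eq_sum hs] at h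

theorem shannonEntropy_le_log_two_add [Fintype ι] [DecidableEq ι] {μ : Measure Ω}
    [IsProbabilityMeasure μ] (hf : Measurable f) {s t : Finset ι} (hs : ∀ x, f x ∈ s)
    (hts : t ⊆ s) : shannonEntropy μ f ≤ Real.log 2 + μ.real (f ⁻¹' t) * Real.log t.card +
      μ.real (f ⁻¹' (s \ t : Finset ι)) * Real.log (s \ t).card := by
  have split := Finset.sum_sdiff (f := fun i => negMulLog (μ.real (f ⁻¹' {i}))) hts
  have total := Finset.sum_sdiff (f := fun i => μ.real (f ⁻¹' {i})) hts
  have bound := fun r : Finset ι => sum_negMulLog_le_of_card_le le_rfl (s := r)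
    (p := fun i => μ.real (f ⁻¹' {i})) fun _ _ => measureReal_nonneg
  have fibers := fun r : Finset ι => sum_measureReal_preimage_singleton (μ := μ) r
    fun i _ => hf (measurableSet_singleton i)
  simp only [fibers] at total bound
  rw [Set.preimage_eq_univ_iff.2 (Set.range_subset_iff.2 hs), probReal_univ] at total
  have binary := Real.binEntropy_le_log_two (p := μ.real (f ⁻¹' t))
  rw [Real.binEntropy_eq_negMulLog_add_negMulLog_one_sub, ← eq_sub_of_add_eq total] at binary
  rw [shannonEntropy_eq_sum hs, ← split]
  linarith [bound t, bound (s \ t)]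

theorem shannonEntropy_le_prodMk [Fintype ι] [Fintype κ] {μ : Measure Ω} [IsFiniteMeasure μ]
    (hf : Measurable f) : shannonEntropy μ g ≤ shannonEntropy μ fun x => (g x, f x) := by
  rw [shannonEntropy_prodMk]
  refine Finset.sum_le_sum fun j _ => ?_
  rw [← sum_measureReal_inter_preimage_singleton μ hf (g ⁻¹' {j})]
  exact negMulLog_sum_le fun _ _ => measureReal_nonneg

variable [Fintype ι] [Fintype κ] [MeasurableSpace κ] [MeasurableSingletonClass κ]

theorem shannonEntropy_prodMk_le {μ : Measure Ω} [IsProbabilityMeasure μ] (hf : Measurable f)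
    (hg : Measurable g) :
    shannonEntropy μ (fun x => (f x, g x)) ≤ shannonEntropy μ f + shannonEntropy μ g := by
  have marginal : ∀ j, ∑ i, μ.real (f ⁻¹' {i} ∩ g ⁻¹' {j}) = μ.real (g ⁻¹' {j}) := fun j => by
    simp only [Set.inter_comm _ (g ⁻¹' _), sum_measureReal_inter_preimage_singleton μ hf]
  rw [shannonEntropy_prodMk]
  refine (sum_negMulLog_le_add_of_sum_eq_one (fun _ _ => measureReal_nonneg) ?_).trans_eq ?_
  · simpa only [marginal, Set.univ_inter, probReal_univ] using
      sum_measureReal_inter_preimage_singleton μ hg Set.univ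
  · simp only [marginal, sum_measureReal_inter_preimage_singleton μ hg, shannonEntropy]

theorem shannonEntropy_le_add_log {μ : Measure Ω} [IsProbabilityMeasure μ] (hf : Measurable f)
    (hg : Measurable g) {M : ℕ} (hM : ∀ j, (f '' (g ⁻¹' {j})).ncard ≤ M) :
    shannonEntropy μ f ≤ shannonEntropy μ g + Real.log M := by
  classical
  have conditional : ∀ j, ∑ i, negMulLog (μ.real (f ⁻¹' {i} ∩ g ⁻¹' {j})) ≤
      negMulLog (μ.real (g ⁻¹' {j})) + μ.real (g ⁻¹' {j}) * Real.log M := fun j => by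
    have outside : ∀ i ∉ (f '' (g ⁻¹' {j})).toFinset, μ.real (f ⁻¹' {i} ∩ g ⁻¹' {j}) = 0 :=
      fun i hi => by
        rw [Set.mem_toFinset] at hi
        rw [Set.eq_empty_of_forall_notMem (s := f ⁻¹' {i} ∩ g ⁻¹' {j})
          fun x hx => hi ⟨x, hx.2, hx.1⟩, measureReal_empty]
    have h := sum_negMulLog_le_of_card_le ((Set.ncard_eq_toFinset_card' _).symm.trans_le (hM j))
      (p := fun i => μ.real (f ⁻¹' {i} ∩ g ⁻¹' {j})) fun _ _ => measureReal_nonneg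
    rw [Finset.sum_subset (Finset.subset_univ _) fun i _ hi => by
        rw [outside i hi, Real.negMulLog_zero],
      Finset.sum_subset (Finset.subset_univ _) fun i _ hi => outside i hi] at h
    simpa only [Set.inter_comm _ (g ⁻¹' _), sum_measureReal_inter_preimage_singleton μ hf] using h
  calc shannonEntropy μ f
      ≤ ∑ j, ∑ i, negMulLog (μ.real (f ⁻¹' {i} ∩ g ⁻¹' {j})) := by
        rw [Finset.sum_comm, ← shannonEntropy_prodMk]
        exact shannonEntropy_le_prodMk hg
    _ ≤ ∑ j, (negMulLog (μ.real (g ⁻¹' {j})) + μ.real (g ⁻¹' {j}) * Real.log M) :=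
        Finset.sum_le_sum fun j _ => conditional j
    _ = shannonEntropy μ g + Real.log M := by
        have total := sum_measureReal_inter_preimage_singleton μ hg Set.univ
        simp only [Set.univ_inter, probReal_univ] at total
        rw [Finset.sum_add_distrib, ← Finset.sum_mul, total, one_mul, shannonEntropy]

end ShannonEntropy

/-! ### Subshifts and the bounded gap property -/

namespace ShiftSpace

variable {n : ℕ} {X : ShiftSpace n} {N : ℕ}

/-- The word that a point carries at the coordinates `0, …, k - 1`. -/
def headWord (X : ShiftSpace n) (k : ℕ) (x : X.Pt) : Fin k → Fin n := fun l => x.1 ((l : ℕ) : ℤ)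

theorem cylinder_eq_preimage {k : ℕ} (w : Fin k → Fin n) :
    X.cylinder w = X.headWord k ⁻¹' {w} := by
  ext x
  simp [cylinder, headWord, funext_iff]

theorem continuous_apply (i : ℤ) : Continuous fun x : X.Pt => x.1 i :=
  (_root_.continuous_apply i).comp continuous_subtype_val

theorem continuous_headWord (k : ℕ) : Continuous (X.headWord k) :=
  continuous_pi fun _ => continuous_apply _

theorem measurable_headWord (k : ℕ) : Measurable (X.headWord k) :=
  (continuous_headWord k).measurable

theorem headWord_eq_iff {k : ℕ} {x y : X.Pt} :
    X.headWord k x = X.headWord k y ↔ ∀ i : ℤ, 0 ≤ i → i < k → x.1 i = y.1 i := by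
  constructor
  · intro h i h0 hk
    lift i to ℕ using h0
    exact congrFun h ⟨i, by exact_mod_cast hk⟩
  · intro h
    funext l
    exact h _ (by positivity) (by exact_mod_cast l.2)

theorem shiftMap_iterate_apply (x : X.Pt) (j : ℕ) (i : ℤ) :
    (X.shiftMap^[j] x).1 i = x.1 (i + j) := by
  induction j generalizing x with
  | zero => simp
  | succ j ih =>
    rw [Function.iterate_succ_apply, ih]
    simp only [shiftMap, shift]
    push_cast
    ring_nf

theorem ncard_words_le (X : ShiftSpace n) (k : ℕ) : (X.words k).ncard ≤ n ^ k := by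
  calc (X.words k).ncard ≤ (Set.univ : Set (Fin k → Fin n)).ncard :=
        Set.ncard_le_ncard (Set.subset_univ _)
    _ = n ^ k := by simp [Set.ncard_univ]

theorem bddBelow_log_ncard_words_div (X : ShiftSpace n) :
    BddBelow (Set.range fun k : ℕ => Real.log (X.words k).ncard / k) :=
  ⟨0, by rintro _ ⟨k, rfl⟩; exact div_nonneg (Real.log_natCast_nonneg _) (Nat.cast_nonneg _)⟩

/-- A nonempty closed set of sequences that is invariant under the shift and its inverse.
(A `ShiftSpace` is only required to be forward invariant.) -/
structure IsSubshift (X : ShiftSpace n) : Prop where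
  isClosed : IsClosed X.carrier
  nonempty : X.carrier.Nonempty
  translate_mem : ∀ x ∈ X.carrier, ∀ t : ℤ, (fun i => x (i + t)) ∈ X.carrier

namespace IsSubshift

/-- The translate of a point by an integer. -/
def translate (hX : X.IsSubshift) (t : ℤ) (x : X.Pt) : X.Pt :=
  ⟨fun i => x.1 (i + t), hX.translate_mem x.1 x.2 t⟩

@[simp] theorem translate_apply (hX : X.IsSubshift) (t : ℤ) (x : X.Pt) (i : ℤ) :
    (hX.translate t x).1 i = x.1 (i + t) := rfl

theorem compactSpace (hX : X.IsSubshift) : CompactSpace X.Pt :=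
  isCompact_iff_compactSpace.1 hX.isClosed.isCompact

theorem nonempty_pt (hX : X.IsSubshift) : Nonempty X.Pt := hX.nonempty.to_subtype

theorem alphabet_pos (hX : X.IsSubshift) : 0 < n := by
  obtain ⟨x⟩ := hX.nonempty_pt
  exact Fin.pos (x.1 0)

theorem words_eq_range (hX : X.IsSubshift) (k : ℕ) : X.words k = Set.range (X.headWord k) := by
  ext w
  constructor
  · rintro ⟨x, hx, i, h⟩
    refine ⟨hX.translate i ⟨x, hx⟩, funext fun l => ?_⟩
    rw [← h l]
    simp [headWord, add_comm]
  · rintro ⟨x, rfl⟩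
    exact ⟨x.1, x.2, 0, fun l => by simp [headWord]⟩

theorem headWord_mem (hX : X.IsSubshift) (k : ℕ) (x : X.Pt) : X.headWord k x ∈ X.words k := by
  rw [hX.words_eq_range]
  exact ⟨x, rfl⟩

theorem exists_headWord_eq (hX : X.IsSubshift) {k : ℕ} (w : X.words k) :
    ∃ x, X.headWord k x = w :=
  (Set.ext_iff.1 (hX.words_eq_range k) w).1 w.2

/-- A point with a prescribed initial word. -/
noncomputable def point (hX : X.IsSubshift) {k : ℕ} (w : X.words k) : X.Pt :=
  (hX.exists_headWord_eq w).choose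

theorem headWord_point (hX : X.IsSubshift) {k : ℕ} (w : X.words k) :
    X.headWord k (hX.point w) = w :=
  (hX.exists_headWord_eq w).choose_spec

theorem ext_point (hX : X.IsSubshift) {k : ℕ} {v w : X.words k}
    (h : ∀ i : ℤ, 0 ≤ i → i < k → (hX.point v).1 i = (hX.point w).1 i) : v = w := by
  apply Subtype.ext
  rw [← hX.headWord_point v, ← hX.headWord_point w]
  exact headWord_eq_iff.2 h

theorem point_apply_of_headWord_eq (hX : X.IsSubshift) {k : ℕ} {w : X.words k} {x : X.Pt}
    (h : X.headWord k x = w) {i : ℤ} (h0 : 0 ≤ i) (hk : i < k) : (hX.point w).1 i = x.1 i :=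
  headWord_eq_iff.1 ((hX.headWord_point w).trans h.symm) i h0 hk

theorem ncard_words_pos (hX : X.IsSubshift) (k : ℕ) : 0 < (X.words k).ncard := by
  obtain ⟨x⟩ := hX.nonempty_pt
  exact (Set.ncard_pos (Set.toFinite _)).2 ⟨_, hX.headWord_mem k x⟩

theorem ncard_words_add_le (hX : X.IsSubshift) (a b : ℕ) :
    (X.words (a + b)).ncard ≤ (X.words a).ncard * (X.words b).ncard := by
  simp only [← Nat.card_coe_set_eq, ← Nat.card_prod]
  refine Nat.card_le_card_of_injective (fun w : X.words (a + b) =>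
    ((⟨_, hX.headWord_mem a (hX.point w)⟩ : X.words a),
      (⟨_, hX.headWord_mem b (hX.translate a (hX.point w))⟩ : X.words b))) ?_
  intro v w h
  simp only [Prod.mk.injEq, Subtype.mk.injEq, headWord_eq_iff, translate_apply] at h
  refine hX.ext_point fun i h0 hi => ?_
  rcases lt_or_ge i a with hia | hia
  · exact h.1 i h0 hia
  · simpa using h.2 (i - a) (by linarith) (by push_cast at hi; linarith)

theorem subadditive_log_ncard_words (hX : X.IsSubshift) :
    Subadditive fun k => Real.log (X.words k).ncard := by
  intro a b
  have ha : ((X.words a).ncard : ℝ) ≠ 0 := by exact_mod_cast (hX.ncard_words_pos a).ne'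
  have hb : ((X.words b).ncard : ℝ) ≠ 0 := by exact_mod_cast (hX.ncard_words_pos b).ne'
  rw [← Real.log_mul ha hb]
  exact Real.log_le_log (by exact_mod_cast hX.ncard_words_pos _)
    (by exact_mod_cast hX.ncard_words_add_le a b)

theorem tendsto_entropy (hX : X.IsSubshift) :
    Tendsto (fun k : ℕ => Real.log (X.words k).ncard / k) atTop (𝓝 X.entropy) := by
  have h := hX.subadditive_log_ncard_words.tendsto_lim X.bddBelow_log_ncard_words_div
  rwa [← h.limsup_eq] at h

theorem entropy_nonneg (hX : X.IsSubshift) : 0 ≤ X.entropy :=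
  ge_of_tendsto' hX.tendsto_entropy fun _ =>
    div_nonneg (Real.log_natCast_nonneg _) (Nat.cast_nonneg _)

theorem log_ncard_words_le (hX : X.IsSubshift) (k : ℕ) :
    Real.log (X.words k).ncard ≤ k * Real.log n := by
  rw [← Real.log_pow]
  exact Real.log_le_log (by exact_mod_cast hX.ncard_words_pos _)
    (by exact_mod_cast ncard_words_le X k)

theorem entropy_le_log (hX : X.IsSubshift) : X.entropy ≤ Real.log n := by
  refine le_of_tendsto hX.tendsto_entropy ?_
  filter_upwards [eventually_gt_atTop 0] with k hk
  rw [div_le_iff₀ (by exact_mod_cast hk), mul_comm]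
  exact hX.log_ncard_words_le k

theorem exp_le_ncard_words (hX : X.IsSubshift) (k : ℕ) :
    Real.exp (X.entropy * k) ≤ (X.words k).ncard := by
  have hpos : (0 : ℝ) < (X.words k).ncard := by exact_mod_cast hX.ncard_words_pos k
  rcases Nat.eq_zero_or_pos k with rfl | hk
  · simpa using Nat.one_le_iff_ne_zero.2 (hX.ncard_words_pos 0).ne'
  · rw [← Real.le_log_iff_exp_le hpos, ← le_div_iff₀ (by exact_mod_cast hk)]
    have h := hX.subadditive_log_ncard_words.tendsto_lim X.bddBelow_log_ncard_words_div
    rw [tendsto_nhds_unique hX.tendsto_entropy h]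
    exact hX.subadditive_log_ncard_words.lim_le_div X.bddBelow_log_ncard_words_div hk.ne'

end IsSubshift

/-- A subshift in which the past of a point and the future of another one can be joined by a word
of length at most `N` (the specification property). -/
structure HasBoundedGaps (X : ShiftSpace n) (N : ℕ) : Prop extends IsSubshift X where
  glue : ∀ x ∈ X.carrier, ∀ y ∈ X.carrier, ∃ g ≤ N, ∃ z ∈ X.carrier,
    (∀ i < 0, z i = x i) ∧ ∀ i : ℤ, 0 ≤ i → z (i + (g : ℕ)) = y i

namespace HasBoundedGaps

theorem glue_at (hX : X.HasBoundedGaps N) (x y : X.Pt) (a : ℤ) :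
    ∃ (g : Fin (N + 1)) (z : X.Pt),
      (∀ i < a, z.1 i = x.1 i) ∧ ∀ i : ℤ, 0 ≤ i → z.1 (a + (g : ℕ) + i) = y.1 i := by
  obtain ⟨g, hg, z, hz, hpast, hfuture⟩ :=
    hX.glue (hX.translate a x).1 (hX.translate a x).2 y.1 y.2
  refine ⟨⟨g, by omega⟩, hX.translate (-a) ⟨z, hz⟩, fun i hi => ?_, fun i hi => ?_⟩
  · simpa using hpast (i + -a) (by linarith)
  · rw [← hfuture i hi, IsSubshift.translate_apply]
    ring_nf

theorem glue_three (hX : X.HasBoundedGaps N) (x y z : X.Pt) (a b : ℕ) :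
    ∃ (g g' : Fin (N + 1)) (t : X.Pt),
      (∀ i : ℤ, i < a → t.1 i = x.1 i) ∧
      (∀ i : ℤ, 0 ≤ i → i < b → t.1 (a + (g : ℕ) + i) = y.1 i) ∧
      ∀ i : ℤ, 0 ≤ i → t.1 (a + (g : ℕ) + b + (g' : ℕ) + i) = z.1 i := by
  obtain ⟨g', s, hsy, hsz⟩ := hX.glue_at y z b
  obtain ⟨g, t, htx, hts⟩ := hX.glue_at x s a
  refine ⟨g, g', t, htx, fun i h0 hb => ?_, fun i h0 => ?_⟩
  · rw [hts i h0, hsy i hb]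
  · rw [← hsz i h0, ← hts _ (by positivity)]
    ring_nf

/-- The constant in the supermultiplicativity of the number of words. -/
def gapConst (n N : ℕ) : ℕ := (N + 1) * n ^ N

theorem gapConst_pos (hX : X.HasBoundedGaps N) : 0 < gapConst n N :=
  Nat.mul_pos N.succ_pos (pow_pos hX.alphabet_pos N)

theorem ncard_words_mul_le (hX : X.HasBoundedGaps N) (a b : ℕ) :
    (X.words a).ncard * (X.words b).ncard ≤ gapConst n N * (X.words (a + b)).ncard := by
  choose g z hz₁ hz₂ using fun p : X.words a × X.words b =>
    hX.glue_at (hX.point p.1) (hX.point p.2) a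
  have hcard : gapConst n N * (X.words (a + b)).ncard =
      Nat.card ((Fin (N + 1) × (Fin N → Fin n)) × X.words (a + b)) := by
    simp [Nat.card_prod, gapConst, Nat.card_coe_set_eq]
  rw [hcard]
  simp only [← Nat.card_coe_set_eq, ← Nat.card_prod]
  -- A pair of words is recovered from the gap and the first `a + b + N` symbols of the glued point.
  refine Nat.card_le_card_of_injective (fun p : X.words a × X.words b =>
    ((g p, X.headWord N (hX.translate (a + b : ℕ) (z p))),
      (⟨_, hX.headWord_mem (a + b) (z p)⟩ : X.words (a + b)))) ?_
  intro p q h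
  simp only [Prod.mk.injEq, Subtype.mk.injEq, headWord_eq_iff, IsSubshift.translate_apply] at h
  obtain ⟨⟨hg, htail⟩, hhead⟩ := h
  have hz : ∀ i : ℤ, 0 ≤ i → i < a + b + N → (z p).1 i = (z q).1 i := by
    intro i h0 hi
    rcases lt_or_ge i (a + b) with hia | hia
    · exact hhead i h0 (by exact_mod_cast hia)
    · simpa using htail (i - (a + b)) (by linarith) (by linarith)
  refine Prod.ext (hX.ext_point fun i h0 hi => ?_) (hX.ext_point fun i h0 hi => ?_)
  · rw [← hz₁ p i hi, ← hz₁ q i hi]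
    exact hz i h0 (by linarith)
  · rw [← hz₂ p i h0, ← hz₂ q i h0, hg]
    have : ((g q : ℕ) : ℤ) ≤ N := by exact_mod_cast Nat.lt_succ_iff.1 (g q).2
    exact hz _ (by positivity) (by linarith)

theorem subadditive_log_gapConst_sub (hX : X.HasBoundedGaps N) :
    Subadditive fun k => Real.log (gapConst n N) - Real.log (X.words k).ncard := by
  intro a b
  have hpos : ∀ k, (0 : ℝ) < (X.words k).ncard := fun k => by exact_mod_cast hX.ncard_words_pos k
  have hK : (gapConst n N : ℝ) ≠ 0 := by exact_mod_cast hX.gapConst_pos.ne'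
  have hmul : ((X.words a).ncard : ℝ) * (X.words b).ncard ≤
      gapConst n N * (X.words (a + b)).ncard := by exact_mod_cast hX.ncard_words_mul_le a b
  have hlog := Real.log_le_log (mul_pos (hpos a) (hpos b)) hmul
  rw [Real.log_mul (hpos a).ne' (hpos b).ne', Real.log_mul hK (hpos _).ne'] at hlog
  linarith

theorem bddBelow_log_gapConst_sub_div (hX : X.HasBoundedGaps N) :
    BddBelow (Set.range fun k : ℕ =>
      (Real.log (gapConst n N) - Real.log (X.words k).ncard) / k) := by
  refine ⟨-Real.log n, ?_⟩
  rintro _ ⟨k, rfl⟩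
  rcases Nat.eq_zero_or_pos k with rfl | hk
  · simpa using Real.log_natCast_nonneg n
  · rw [le_div_iff₀ (by exact_mod_cast hk)]
    linarith [hX.log_ncard_words_le k, Real.log_natCast_nonneg (gapConst n N)]

theorem ncard_words_le_exp (hX : X.HasBoundedGaps N) (k : ℕ) :
    ((X.words k).ncard : ℝ) ≤ gapConst n N * Real.exp (X.entropy * k) := by
  have hpos : (0 : ℝ) < (X.words k).ncard := by exact_mod_cast hX.ncard_words_pos k
  have hK : (0 : ℝ) < gapConst n N := by exact_mod_cast hX.gapConst_pos
  rcases Nat.eq_zero_or_pos k with rfl | hk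
  · simpa using (ncard_words_le X 0).trans hX.gapConst_pos
  have hlim : Tendsto (fun k : ℕ => (Real.log (gapConst n N) - Real.log (X.words k).ncard) / k)
      atTop (𝓝 (0 - X.entropy)) := by
    simp only [sub_div]
    exact (tendsto_const_div_atTop_nhds_zero_nat _).sub hX.tendsto_entropy
  have hsub := hX.subadditive_log_gapConst_sub
  have hbdd := hX.bddBelow_log_gapConst_sub_div
  have h := hsub.lim_le_div hbdd hk.ne'
  rw [tendsto_nhds_unique (hsub.tendsto_lim hbdd) hlim, le_div_iff₀ (by exact_mod_cast hk)] at h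
  rw [← Real.log_le_log_iff hpos (by positivity), Real.log_mul hK.ne' (Real.exp_pos _).ne',
    Real.log_exp]
  linarith

end HasBoundedGaps

end ShiftSpace

/-! ### Construction of a Gibbs measure -/

section Clopen

variable {α : Type*} [TopologicalSpace α] [MeasurableSpace α] [BorelSpace α]

theorem tendsto_measureReal_of_isClopen [HasOuterApproxClosed α] {ι : Type*} {l : Filter ι}
    {μs : ι → ProbabilityMeasure α} {μ : ProbabilityMeasure α} (h : Tendsto μs l (𝓝 μ))
    {S : Set α} (hS : IsClopen S) :
    Tendsto (fun i => (μs i : Measure α).real S) l (𝓝 ((μ : Measure α).real S)) :=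
  (ENNReal.tendsto_toReal (measure_ne_top _ _)).comp
    (ProbabilityMeasure.tendsto_measure_of_null_frontier_of_tendsto' h (by simp [hS.frontier_eq]))

theorem measurePreserving_of_isClopen [T2Space α] [CompactSpace α] [TotallyDisconnectedSpace α]
    [SecondCountableTopology α] {f : α → α} (hf : Continuous f) {μ : Measure α}
    [IsFiniteMeasure μ] (h : ∀ S, IsClopen S → μ (f ⁻¹' S) = μ S) : MeasurePreserving f μ μ := by
  refine ⟨hf.measurable, ?_⟩
  refine ext_of_generate_finite {S : Set α | IsClopen S} ?_ (fun s hs t ht _ => hs.inter ht) ?_ ?_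
  · rw [← (isTopologicalBasis_isClopen (X := α)).borel_eq_generateFrom]
    exact BorelSpace.measurable_eq
  · intro S hS
    rw [Measure.map_apply hf.measurable hS.isOpen.measurableSet, h S hS]
  · rw [Measure.map_apply hf.measurable MeasurableSet.univ, Set.preimage_univ]

end Clopen

namespace ShiftSpace

variable {n : ℕ} {X : ShiftSpace n} {N : ℕ}

theorem continuous_shiftMap (X : ShiftSpace n) : Continuous X.shiftMap :=
  Continuous.subtype_mk (continuous_pi fun i => continuous_apply (i + 1)) _

theorem isClopen_cylinder (X : ShiftSpace n) {k : ℕ} (w : Fin k → Fin n) :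
    IsClopen (X.cylinder w) := by
  rw [cylinder_eq_preimage]
  exact (isClopen_discrete {w}).preimage (continuous_headWord k)

theorem mem_cylinder_headWord {k : ℕ} {x y : X.Pt} :
    y ∈ X.cylinder (X.headWord k x) ↔ ∀ i : ℤ, 0 ≤ i → i < k → y.1 i = x.1 i := by
  rw [cylinder_eq_preimage]
  exact headWord_eq_iff

/-- A Gibbs measure for the zero potential: an invariant measure that gives each cylinder of
length `k` the mass `exp (-k h)`, up to the constants `c` and `C`. -/
structure IsGibbs (X : ShiftSpace n) (ν : Measure X.Pt) (c C : ℝ) : Prop where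
  measurePreserving : MeasurePreserving X.shiftMap ν ν
  pos : 0 < c
  le_measure : ∀ (k : ℕ) (x : X.Pt), c * Real.exp (-(X.entropy * k)) ≤
    ν.real (X.cylinder (X.headWord k x))
  measure_le : ∀ (k : ℕ) (x : X.Pt), ν.real (X.cylinder (X.headWord k x)) ≤
    C * Real.exp (-(X.entropy * k))

namespace IsSubshift

/-- The number of words of length `L` whose chosen point lies in `S` after `j` shifts. -/
noncomputable def visitCount (hX : X.IsSubshift) (L : ℕ) (S : Set X.Pt) (j : ℕ) : ℕ :=
  Nat.card {w : X.words L // X.shiftMap^[j] (hX.point w) ∈ S}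

theorem visitCount_le (hX : X.IsSubshift) (L : ℕ) (S : Set X.Pt) (j : ℕ) :
    hX.visitCount L S j ≤ (X.words L).ncard := by
  rw [visitCount, ← Nat.card_coe_set_eq]
  exact Nat.card_le_card_of_injective _ Subtype.val_injective

theorem visitCount_preimage_shiftMap (hX : X.IsSubshift) (L : ℕ) (S : Set X.Pt) (j : ℕ) :
    hX.visitCount L (X.shiftMap ⁻¹' S) j = hX.visitCount L S (j + 1) := by
  simp only [visitCount, Function.iterate_succ_apply', Set.mem_preimage]

theorem visitCount_cylinder_le (hX : X.IsSubshift) {L l j : ℕ} (hj : j + l ≤ L) (x : X.Pt) :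
    hX.visitCount L (X.cylinder (X.headWord l x)) j ≤
      (X.words j).ncard * (X.words (L - j - l)).ncard := by
  simp only [visitCount, ← Nat.card_coe_set_eq, ← Nat.card_prod]
  refine Nat.card_le_card_of_injective (fun w =>
    ((⟨_, hX.headWord_mem j (hX.point w.1)⟩ : X.words j),
      (⟨_, hX.headWord_mem (L - j - l) (hX.translate (j + l : ℕ) (hX.point w.1))⟩ :
        X.words (L - j - l)))) ?_
  rintro ⟨v, hv⟩ ⟨w, hw⟩ h
  simp only [Prod.mk.injEq, Subtype.mk.injEq, headWord_eq_iff, translate_apply] at h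
  simp only [mem_cylinder_headWord, shiftMap_iterate_apply] at hv hw
  refine Subtype.ext (hX.ext_point fun i h0 hi => ?_)
  rcases lt_or_ge i j with hij | hij
  · exact h.1 i h0 hij
  rcases lt_or_ge i (j + l) with hil | hil
  · have hvx := hv (i - j) (by linarith) (by linarith)
    have hwx := hw (i - j) (by linarith) (by linarith)
    rw [sub_add_cancel] at hvx hwx
    rw [hvx, hwx]
  · simpa using h.2 (i - (j + l)) (by linarith) (by push_cast [Nat.sub_sub]; omega)

/-- The uniform distribution on the points `σ ^ j x_w`, where `j ≤ k` and `w` is a word of length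
`k + 1`. -/
noncomputable def orbitMeasure (hX : X.IsSubshift) (k : ℕ) : ProbabilityMeasure X.Pt :=
  haveI : Nonempty (X.words (k + 1)) :=
    (Set.nonempty_of_ncard_ne_zero (hX.ncard_words_pos _).ne').to_subtype
  haveI : Fintype (X.words (k + 1)) := Fintype.ofFinite _
  letI : MeasurableSpace (Fin (k + 1) × X.words (k + 1)) := ⊤
  ⟨((PMF.uniformOfFintype (Fin (k + 1) × X.words (k + 1))).toMeasure).map
    (fun p => X.shiftMap^[p.1] (hX.point p.2)),
    Measure.isProbabilityMeasure_map measurable_from_top.aemeasurable⟩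

theorem orbitMeasure_real (hX : X.IsSubshift) (k : ℕ) {S : Set X.Pt} (hS : MeasurableSet S) :
    (hX.orbitMeasure k : Measure X.Pt).real S =
      (∑ j ∈ Finset.range (k + 1), (hX.visitCount (k + 1) S j : ℝ)) /
        ((k + 1 : ℕ) * (X.words (k + 1)).ncard) := by
  classical
  have : Nonempty (X.words (k + 1)) :=
    (Set.nonempty_of_ncard_ne_zero (hX.ncard_words_pos _).ne').to_subtype
  let _ : Fintype (X.words (k + 1)) := Fintype.ofFinite _
  let _ : MeasurableSpace (Fin (k + 1) × X.words (k + 1)) := ⊤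
  have hmap : (hX.orbitMeasure k : Measure X.Pt) S =
      (PMF.uniformOfFintype (Fin (k + 1) × X.words (k + 1))).toMeasure
        ((fun p => X.shiftMap^[p.1] (hX.point p.2)) ⁻¹' S) :=
    Measure.map_apply measurable_from_top hS
  rw [measureReal_def, hmap,
    PMF.toMeasure_uniformOfFintype_apply _ MeasurableSpace.measurableSet_top, ENNReal.toReal_div,
    ENNReal.toReal_natCast, ENNReal.toReal_natCast, Fintype.card_prod, Fintype.card_fin,
    ← Nat.card_coe_set_eq, Nat.card_eq_fintype_card, Nat.cast_mul]
  congr 1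
  rw [Fintype.card_subtype, Finset.card_filter, Fintype.sum_prod_type, ← Nat.cast_sum,
    ← Fin.sum_univ_eq_sum_range]
  congr 1
  refine Finset.sum_congr rfl fun j _ => ?_
  rw [visitCount, Nat.card_eq_fintype_card, Fintype.card_subtype, Finset.card_filter]
  rfl

theorem abs_orbitMeasure_preimage_sub_le (hX : X.IsSubshift) (k : ℕ) {S : Set X.Pt}
    (hS : MeasurableSet S) :
    |(hX.orbitMeasure k : Measure X.Pt).real (X.shiftMap ⁻¹' S) -
      (hX.orbitMeasure k : Measure X.Pt).real S| ≤ 1 / (k + 1 : ℕ) := by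
  have hwords : (0 : ℝ) < (X.words (k + 1)).ncard := by exact_mod_cast hX.ncard_words_pos _
  rw [hX.orbitMeasure_real k hS, hX.orbitMeasure_real k (X.continuous_shiftMap.measurable hS),
    ← sub_div]
  simp only [visitCount_preimage_shiftMap]
  have htel := Finset.sum_range_succ (fun j => (hX.visitCount (k + 1) S j : ℝ)) (k + 1)
  rw [Finset.sum_range_succ'] at htel
  have hlast : (hX.visitCount (k + 1) S (k + 1) : ℝ) ≤ (X.words (k + 1)).ncard := by
    exact_mod_cast hX.visitCount_le _ _ _
  have hfirst : (hX.visitCount (k + 1) S 0 : ℝ) ≤ (X.words (k + 1)).ncard := by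
    exact_mod_cast hX.visitCount_le _ _ _
  rw [abs_div, abs_of_nonneg (show (0 : ℝ) ≤ (k + 1 : ℕ) * (X.words (k + 1)).ncard by positivity),
    div_le_div_iff₀ (by positivity) (by positivity), one_mul, mul_comm]
  gcongr
  rw [abs_le]
  constructor
  · linarith [Nat.cast_nonneg (α := ℝ) (hX.visitCount (k + 1) S (k + 1))]
  · linarith [Nat.cast_nonneg (α := ℝ) (hX.visitCount (k + 1) S 0)]

theorem measurePreserving_of_tendsto_orbitMeasure (hX : X.IsSubshift) {U : Filter ℕ} [U.NeBot]
    (hU : U ≤ atTop) {ν : ProbabilityMeasure X.Pt} (hν : Tendsto hX.orbitMeasure U (𝓝 ν)) :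
    MeasurePreserving X.shiftMap (ν : Measure X.Pt) ν := by
  have := hX.compactSpace
  refine measurePreserving_of_isClopen X.continuous_shiftMap fun S hS => ?_
  have hdiff := ((tendsto_measureReal_of_isClopen hν (hS.preimage X.continuous_shiftMap)).sub
    (tendsto_measureReal_of_isClopen hν hS)).abs
  have hdiv := ((tendsto_const_div_atTop_nhds_zero_nat (1 : ℝ)).comp
    (tendsto_add_atTop_nat 1)).mono_left hU
  have h := le_of_tendsto_of_tendsto' hdiff hdiv
    fun k => hX.abs_orbitMeasure_preimage_sub_le k hS.isOpen.measurableSet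
  exact (measureReal_eq_measureReal_iff).1 (sub_eq_zero.1 (abs_nonpos_iff.1 h))

end IsSubshift

namespace HasBoundedGaps

theorem exists_word_glue_three (hX : X.HasBoundedGaps N) {L l j : ℕ} (hj : N ≤ j)
    (hjl : j + l + N ≤ L) (x : X.Pt) (u : X.words (j - N)) (v : X.words (L - j - l - N)) :
    ∃ (g g' : Fin (N + 1)) (w : X.words L),
      X.shiftMap^[j] (hX.point w) ∈ X.cylinder (X.headWord l x) ∧
      (∀ i : ℤ, 0 ≤ i → i < (j - N : ℕ) →
        (hX.point w).1 (i + N - (g : ℕ)) = (hX.point u).1 i) ∧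
      ∀ i : ℤ, 0 ≤ i → i < (L - j - l - N : ℕ) →
        (hX.point w).1 (j + l + (g' : ℕ) + i) = (hX.point v).1 i := by
  obtain ⟨g, g', t, htu, htx, htv⟩ := hX.glue_three (hX.point u) x (hX.point v) (j - N) l
  have hg : ((g : ℕ) : ℤ) ≤ N := by exact_mod_cast Nat.lt_succ_iff.1 g.2
  have hg' : ((g' : ℕ) : ℤ) ≤ N := by exact_mod_cast Nat.lt_succ_iff.1 g'.2
  have hjN : ((j - N : ℕ) : ℤ) = j - N := by push_cast [hj]; ring
  let w : X.words L := ⟨_, hX.headWord_mem L (hX.translate ((g : ℕ) - N) t)⟩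
  have hw : ∀ i : ℤ, 0 ≤ i → i < L → (hX.point w).1 i = t.1 (i + ((g : ℕ) - N)) :=
    fun i h0 hi => hX.point_apply_of_headWord_eq
      (x := hX.translate ((g : ℕ) - N) t) (w := w) rfl h0 hi
  refine ⟨g, g', w, mem_cylinder_headWord.2 fun i h0 hi => ?_, fun i h0 hi => ?_,
    fun i h0 hi => ?_⟩
  · rw [shiftMap_iterate_apply, hw _ (by positivity) (by omega), ← htx i h0 hi, hjN]
    ring_nf
  · rw [hw _ (by linarith) (by omega), ← htu i hi]
    ring_nf
  · rw [hw _ (by positivity) (by omega), ← htv i h0, hjN]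
    ring_nf

theorem le_visitCount_cylinder (hX : X.HasBoundedGaps N) {L l j : ℕ} (hj : N ≤ j)
    (hjl : j + l + N ≤ L) (x : X.Pt) :
    (X.words (j - N)).ncard * (X.words (L - j - l - N)).ncard ≤
      (N + 1) ^ 2 * hX.visitCount L (X.cylinder (X.headWord l x)) j := by
  choose g g' w hwx hw₁ hw₂ using fun p : X.words (j - N) × X.words (L - j - l - N) =>
    hX.exists_word_glue_three hj hjl x p.1 p.2
  have hcard : (N + 1) ^ 2 * hX.visitCount L (X.cylinder (X.headWord l x)) j =
      Nat.card ((Fin (N + 1) × Fin (N + 1)) ×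
        {w : X.words L // X.shiftMap^[j] (hX.point w) ∈ X.cylinder (X.headWord l x)}) := by
    rw [IsSubshift.visitCount, Nat.card_prod, Nat.card_prod, Nat.card_fin, sq]
  rw [hcard]
  simp only [← Nat.card_coe_set_eq, ← Nat.card_prod]
  refine Nat.card_le_card_of_injective (fun p => ((g p, g' p), ⟨w p, hwx p⟩)) ?_
  intro p q h
  simp only [Prod.mk.injEq, Subtype.mk.injEq] at h
  obtain ⟨⟨hg, hg'⟩, hw⟩ := h
  refine Prod.ext (hX.ext_point fun i h0 hi => ?_) (hX.ext_point fun i h0 hi => ?_)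
  · rw [← hw₁ p i h0 hi, ← hw₁ q i h0 hi, hg, hw]
  · rw [← hw₂ p i h0 hi, ← hw₂ q i h0 hi, hg', hw]

theorem visitCount_cylinder_le_exp (hX : X.HasBoundedGaps N) {L l j : ℕ} (hj : j + l ≤ L)
    (x : X.Pt) : (hX.visitCount L (X.cylinder (X.headWord l x)) j : ℝ) ≤
      gapConst n N ^ 2 * Real.exp (X.entropy * (L - l)) := by
  calc (hX.visitCount L (X.cylinder (X.headWord l x)) j : ℝ)
      ≤ (X.words j).ncard * (X.words (L - j - l)).ncard := by
        exact_mod_cast hX.visitCount_cylinder_le hj x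
    _ ≤ (gapConst n N * Real.exp (X.entropy * j)) *
        (gapConst n N * Real.exp (X.entropy * (L - j - l : ℕ))) :=
        mul_le_mul (hX.ncard_words_le_exp _) (hX.ncard_words_le_exp _) (by positivity)
          (by positivity)
    _ = _ := by
        have : ((L - j - l : ℕ) : ℝ) = L - j - l := by
          rw [Nat.sub_sub, Nat.cast_sub hj]; push_cast; ring
        rw [this, mul_mul_mul_comm, ← Real.exp_add, sq]
        ring_nf

theorem exp_le_visitCount_cylinder (hX : X.HasBoundedGaps N) {L l j : ℕ} (hj : N ≤ j)
    (hjl : j + l + N ≤ L) (x : X.Pt) : Real.exp (X.entropy * (L - l - 2 * N)) ≤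
      (N + 1) ^ 2 * (hX.visitCount L (X.cylinder (X.headWord l x)) j : ℝ) := by
  calc Real.exp (X.entropy * (L - l - 2 * N))
      = Real.exp (X.entropy * (j - N : ℕ)) * Real.exp (X.entropy * (L - j - l - N : ℕ)) := by
        have : ((L - j - l - N : ℕ) : ℝ) = L - j - l - N := by
          rw [Nat.sub_sub, Nat.sub_sub, ← add_assoc, Nat.cast_sub hjl]; push_cast; ring
        rw [this, Nat.cast_sub hj, ← Real.exp_add]
        ring_nf
    _ ≤ (X.words (j - N)).ncard * (X.words (L - j - l - N)).ncard :=
        mul_le_mul (hX.exp_le_ncard_words _) (hX.exp_le_ncard_words _) (by positivity)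
          (by positivity)
    _ ≤ _ := by exact_mod_cast hX.le_visitCount_cylinder hj hjl x

theorem sum_visitCount_cylinder_le (hX : X.HasBoundedGaps N) (L l : ℕ) (x : X.Pt) :
    ∑ j ∈ Finset.range L, (hX.visitCount L (X.cylinder (X.headWord l x)) j : ℝ) ≤
      L * (gapConst n N ^ 2 * Real.exp (X.entropy * (L - l))) + l * (X.words L).ncard := by
  have hterm : ∀ j ∈ Finset.range L, (hX.visitCount L (X.cylinder (X.headWord l x)) j : ℝ) ≤
      gapConst n N ^ 2 * Real.exp (X.entropy * (L - l)) +
        if L < j + l then ((X.words L).ncard : ℝ) else 0 := by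
    intro j _
    split_ifs with h
    · have : (hX.visitCount L (X.cylinder (X.headWord l x)) j : ℝ) ≤ (X.words L).ncard := by
        exact_mod_cast hX.visitCount_le _ _ _
      linarith [show 0 ≤ (gapConst n N : ℝ) ^ 2 * Real.exp (X.entropy * (L - l)) by positivity]
    · simpa using hX.visitCount_cylinder_le_exp (not_lt.1 h) x
  have hlate : ((Finset.range L).filter fun j => L < j + l).card ≤ l := by
    have hsub : ((Finset.range L).filter fun j => L < j + l) ⊆ Finset.Ico (L - l) L := by
      intro j
      simp only [Finset.mem_filter, Finset.mem_range, Finset.mem_Ico]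
      omega
    exact (Finset.card_le_card hsub).trans (by rw [Nat.card_Ico]; omega)
  refine (Finset.sum_le_sum hterm).trans ?_
  rw [Finset.sum_add_distrib, Finset.sum_const, Finset.card_range, nsmul_eq_mul,
    ← Finset.sum_filter, Finset.sum_const, nsmul_eq_mul]
  gcongr

theorem le_sum_visitCount_cylinder (hX : X.HasBoundedGaps N) {L l : ℕ} (hL : l + 2 * N ≤ L)
    (x : X.Pt) :
    ((L : ℝ) - (l + 2 * N : ℕ)) * (Real.exp (X.entropy * (L - l - 2 * N)) / (N + 1) ^ 2) ≤
      ∑ j ∈ Finset.range L, (hX.visitCount L (X.cylinder (X.headWord l x)) j : ℝ) := by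
  calc _ ≤ ∑ j ∈ Finset.Ico N (L - l - N),
        Real.exp (X.entropy * (L - l - 2 * N)) / (N + 1) ^ 2 := by
        rw [Finset.sum_const, nsmul_eq_mul, Nat.card_Ico]
        gcongr
        rw [← Nat.cast_sub hL]
        exact_mod_cast (by omega : L - (l + 2 * N) ≤ L - l - N - N)
    _ ≤ ∑ j ∈ Finset.Ico N (L - l - N),
        (hX.visitCount L (X.cylinder (X.headWord l x)) j : ℝ) := by
        refine Finset.sum_le_sum fun j hj => ?_
        rw [Finset.mem_Ico] at hj
        rw [div_le_iff₀' (by positivity)]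
        exact hX.exp_le_visitCount_cylinder hj.1 (by omega) x
    _ ≤ _ := by
        refine Finset.sum_le_sum_of_subset_of_nonneg ?_ fun _ _ _ => by positivity
        intro j
        simp only [Finset.mem_Ico, Finset.mem_range]
        omega

theorem orbitMeasure_cylinder_le (hX : X.HasBoundedGaps N) (k l : ℕ) (x : X.Pt) :
    (hX.orbitMeasure k : Measure X.Pt).real (X.cylinder (X.headWord l x)) ≤
      l / (k + 1 : ℕ) + gapConst n N ^ 2 * Real.exp (-(X.entropy * l)) := by
  rw [hX.orbitMeasure_real k (X.isClopen_cylinder _).isOpen.measurableSet]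
  set L := k + 1
  have hL : (0 : ℝ) < L := by positivity
  have hwords : (0 : ℝ) < (X.words L).ncard := by exact_mod_cast hX.ncard_words_pos L
  have hexp : Real.exp (X.entropy * (L - l)) ≤
      Real.exp (-(X.entropy * l)) * (X.words L).ncard := by
    rw [show X.entropy * ((L : ℝ) - l) = -(X.entropy * l) + X.entropy * L by ring, Real.exp_add]
    gcongr
    exact hX.exp_le_ncard_words L
  rw [div_le_iff₀ (by positivity)]
  calc ∑ j ∈ Finset.range L, (hX.visitCount L (X.cylinder (X.headWord l x)) j : ℝ)
      ≤ L * (gapConst n N ^ 2 * Real.exp (X.entropy * (L - l))) + l * (X.words L).ncard :=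
        hX.sum_visitCount_cylinder_le L l x
    _ ≤ L * (gapConst n N ^ 2 * (Real.exp (-(X.entropy * l)) * (X.words L).ncard)) +
        l * (X.words L).ncard := by gcongr
    _ = _ := by field_simp; ring

/-- The lower constant in the Gibbs property of the limits of the orbit measures. -/
noncomputable def gibbsConst (X : ShiftSpace n) (N : ℕ) : ℝ :=
  Real.exp (-(X.entropy * (2 * N))) / ((N + 1) ^ 2 * gapConst n N)

theorem gibbsConst_pos (hX : X.HasBoundedGaps N) : 0 < gibbsConst X N := by
  have : (0 : ℝ) < gapConst n N := by exact_mod_cast hX.gapConst_pos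
  exact div_pos (Real.exp_pos _) (by positivity)

theorem le_orbitMeasure_cylinder (hX : X.HasBoundedGaps N) (k l : ℕ) (hk : l + 2 * N ≤ k + 1)
    (x : X.Pt) :
    (1 - (l + 2 * N : ℕ) / (k + 1 : ℕ)) * (gibbsConst X N * Real.exp (-(X.entropy * l))) ≤
      (hX.orbitMeasure k : Measure X.Pt).real (X.cylinder (X.headWord l x)) := by
  rw [hX.orbitMeasure_real k (X.isClopen_cylinder _).isOpen.measurableSet]
  set L := k + 1
  have hL : (0 : ℝ) < L := by positivity
  have hwords : (0 : ℝ) < (X.words L).ncard := by exact_mod_cast hX.ncard_words_pos L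
  have hK : (0 : ℝ) < gapConst n N := by exact_mod_cast hX.gapConst_pos
  have hc := hX.gibbsConst_pos
  have hlen : (0 : ℝ) ≤ (L : ℝ) - (l + 2 * N : ℕ) := by
    rw [← Nat.cast_sub hk]
    positivity
  have hexp : gibbsConst X N * Real.exp (-(X.entropy * l)) *
      (gapConst n N * Real.exp (X.entropy * L)) =
      Real.exp (X.entropy * (L - l - 2 * N)) / (N + 1) ^ 2 := by
    rw [gibbsConst, show X.entropy * ((L : ℝ) - l - 2 * N) =
      -(X.entropy * (2 * N)) + -(X.entropy * l) + X.entropy * L by ring, Real.exp_add,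
      Real.exp_add]
    field_simp
  rw [le_div_iff₀ (by positivity)]
  calc (1 - ((l + 2 * N : ℕ) : ℝ) / L) * (gibbsConst X N * Real.exp (-(X.entropy * l))) *
        (L * (X.words L).ncard)
      = ((L : ℝ) - (l + 2 * N : ℕ)) *
        (gibbsConst X N * Real.exp (-(X.entropy * l)) * (X.words L).ncard) := by field_simp
    _ ≤ ((L : ℝ) - (l + 2 * N : ℕ)) * (gibbsConst X N * Real.exp (-(X.entropy * l)) *
        (gapConst n N * Real.exp (X.entropy * L))) := by
        gcongr
        exact hX.ncard_words_le_exp L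
    _ ≤ _ := by
        rw [hexp]
        exact hX.le_sum_visitCount_cylinder hk x

theorem isGibbs_of_tendsto_orbitMeasure (hX : X.HasBoundedGaps N) {U : Filter ℕ} [U.NeBot]
    (hU : U ≤ atTop) {ν : ProbabilityMeasure X.Pt} (hν : Tendsto hX.orbitMeasure U (𝓝 ν)) :
    X.IsGibbs ν (gibbsConst X N) (gapConst n N ^ 2) := by
  have hdiv : ∀ a : ℝ, Tendsto (fun k : ℕ => a / (k + 1 : ℕ)) U (𝓝 0) := fun a =>
    ((tendsto_const_div_atTop_nhds_zero_nat a).comp (tendsto_add_atTop_nat 1)).mono_left hU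
  have hcyl := fun (l : ℕ) (x : X.Pt) =>
    tendsto_measureReal_of_isClopen hν (X.isClopen_cylinder (X.headWord l x))
  refine ⟨hX.measurePreserving_of_tendsto_orbitMeasure hU hν, hX.gibbsConst_pos, fun l x => ?_,
    fun l x => ?_⟩
  · have hlow := ((tendsto_const_nhds (x := (1 : ℝ))).sub (hdiv (l + 2 * N : ℕ))).mul_const
      (gibbsConst X N * Real.exp (-(X.entropy * l)))
    rw [sub_zero, one_mul] at hlow
    refine le_of_tendsto_of_tendsto hlow (hcyl l x) ?_
    filter_upwards [hU (eventually_ge_atTop (l + 2 * N))] with k hk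
    exact hX.le_orbitMeasure_cylinder k l (Nat.le_succ_of_le hk) x
  · have hup := (hdiv l).add_const ((gapConst n N : ℝ) ^ 2 * Real.exp (-(X.entropy * l)))
    rw [zero_add] at hup
    exact le_of_tendsto_of_tendsto' (hcyl l x) hup fun k => hX.orbitMeasure_cylinder_le k l x

theorem exists_isGibbs (hX : X.HasBoundedGaps N) :
    ∃ (ν : ProbabilityMeasure X.Pt) (c C : ℝ), X.IsGibbs ν c C := by
  have := hX.compactSpace
  obtain ⟨ν, hν⟩ : ∃ ν, Tendsto hX.orbitMeasure (hyperfilter ℕ) (𝓝 ν) :=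
    ⟨_, ((hyperfilter ℕ).map hX.orbitMeasure).le_nhds_lim⟩
  exact ⟨ν, _, _, hX.isGibbs_of_tendsto_orbitMeasure Nat.hyperfilter_le_atTop hν⟩

end HasBoundedGaps

end ShiftSpace

/-! ### Uniqueness of the measure of maximal entropy -/

theorem measureReal_inter_preimage_le {Ω : Type*} [MeasurableSpace Ω] {μ : Measure Ω}
    [IsFiniteMeasure μ] {f : Ω → Ω} (hf : MeasurePreserving f μ μ) {A K K' E E' : Set Ω}
    (hA : f ⁻¹' A = A) (hKA : K ⊆ A) (hKA' : K' ⊆ Aᶜ) (hK : MeasurableSet K)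
    (hK' : MeasurableSet K') (hKE : K ⊆ E) (hKE' : K' ⊆ E') (hE' : MeasurableSet E') :
    μ.real (E ∩ f ⁻¹' E') ≤ (μ.real E - μ.real K) + (μ.real E' - μ.real K') := by
  have hsub : E ∩ f ⁻¹' E' ⊆ (E \ K) ∪ f ⁻¹' (E' \ K') := by
    rintro x ⟨hx, hfx⟩
    by_cases hxK : x ∈ K
    · refine Or.inr ⟨hfx, fun hfxK => hKA' hfxK ?_⟩
      rw [← Set.mem_preimage, hA]
      exact hKA hxK
    · exact Or.inl ⟨hx, hxK⟩
  calc μ.real (E ∩ f ⁻¹' E') ≤ μ.real (E \ K) + μ.real (f ⁻¹' (E' \ K')) :=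
        (measureReal_mono hsub).trans (measureReal_union_le _ _)
    _ = _ := by
        rw [hf.measureReal_preimage (hE'.diff hK').nullMeasurableSet, measureReal_sdiff hKE hK,
          measureReal_sdiff hKE' hK']

namespace ShiftSpace

variable {n : ℕ} {X : ShiftSpace n} {N : ℕ} {μ : Measure X.Pt}

theorem measureEntropy_eq_limsup (μ : ProbabilityMeasure X.Pt) : X.measureEntropy μ =
    limsup (fun k : ℕ => shannonEntropy (μ : Measure X.Pt) (X.headWord k) / k) atTop := by
  simp only [measureEntropy, shannonEntropy, cylinder_eq_preimage]

theorem headWord_add (a b : ℕ) : X.headWord (a + b) = Fin.appendEquiv a b ∘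
    fun x => (X.headWord a x, X.headWord b (X.shiftMap^[a] x)) := by
  funext x l
  refine Fin.addCases (fun i => ?_) (fun i => ?_) l
  · simp [headWord, Fin.appendEquiv]
  · simp [headWord, Fin.appendEquiv, shiftMap_iterate_apply, add_comm]

theorem measurable_iterate_shiftMap (X : ShiftSpace n) (k : ℕ) : Measurable X.shiftMap^[k] :=
  X.continuous_shiftMap.measurable.iterate k

theorem subadditive_shannonEntropy [IsProbabilityMeasure μ]
    (hμ : MeasurePreserving X.shiftMap μ μ) :
    Subadditive fun k => shannonEntropy μ (X.headWord k) := by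
  intro a b
  have hb := X.measurable_headWord b
  have invariant : shannonEntropy μ (fun x => X.headWord b (X.shiftMap^[a] x)) =
      shannonEntropy μ (X.headWord b) :=
    Finset.sum_congr rfl fun w _ => congrArg _ <|
      (hμ.iterate a).measureReal_preimage (hb (measurableSet_singleton w)).nullMeasurableSet
  simp only [headWord_add, shannonEntropy_equiv]
  rw [← invariant]
  exact shannonEntropy_prodMk_le (X.measurable_headWord a)
    (hb.comp (X.measurable_iterate_shiftMap a))

theorem bddBelow_shannonEntropy_div (μ : Measure X.Pt) [IsProbabilityMeasure μ] :
    BddBelow (Set.range fun k : ℕ => shannonEntropy μ (X.headWord k) / k) :=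
  ⟨0, by rintro _ ⟨k, rfl⟩; exact div_nonneg shannonEntropy_nonneg (Nat.cast_nonneg _)⟩

theorem measureEntropy_eq_lim {μ : ProbabilityMeasure X.Pt}
    (hμ : MeasurePreserving X.shiftMap (μ : Measure X.Pt) μ) :
    X.measureEntropy μ = (subadditive_shannonEntropy hμ).lim := by
  rw [measureEntropy_eq_limsup]
  exact ((subadditive_shannonEntropy hμ).tendsto_lim (bddBelow_shannonEntropy_div _)).limsup_eq

theorem tendsto_measureEntropy {μ : ProbabilityMeasure X.Pt}
    (hμ : MeasurePreserving X.shiftMap (μ : Measure X.Pt) μ) :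
    Tendsto (fun k : ℕ => shannonEntropy (μ : Measure X.Pt) (X.headWord k) / k) atTop
      (𝓝 (X.measureEntropy μ)) := by
  rw [measureEntropy_eq_lim hμ]
  exact (subadditive_shannonEntropy hμ).tendsto_lim (bddBelow_shannonEntropy_div _)

theorem measureEntropy_mul_le {μ : ProbabilityMeasure X.Pt}
    (hμ : MeasurePreserving X.shiftMap (μ : Measure X.Pt) μ) (k : ℕ) :
    X.measureEntropy μ * k ≤ shannonEntropy (μ : Measure X.Pt) (X.headWord k) := by
  rcases Nat.eq_zero_or_pos k with rfl | hk
  · simpa using shannonEntropy_nonneg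
  · rw [← le_div_iff₀ (by exact_mod_cast hk), measureEntropy_eq_lim hμ]
    exact (subadditive_shannonEntropy hμ).lim_le_div (bddBelow_shannonEntropy_div _) hk.ne'

theorem IsSubshift.measureEntropy_le (hX : X.IsSubshift) {μ : ProbabilityMeasure X.Pt}
    (hμ : MeasurePreserving X.shiftMap (μ : Measure X.Pt) μ) :
    X.measureEntropy μ ≤ X.entropy := by
  classical
  refine le_of_tendsto_of_tendsto' (tendsto_measureEntropy hμ) hX.tendsto_entropy fun k => ?_
  gcongr
  rw [Set.ncard_eq_toFinset_card']
  exact shannonEntropy_le_log_card (X.measurable_headWord k)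
    fun x => by simpa using hX.headWord_mem k x

/-- The word of length `2 * p` that a point carries at the coordinates `-p, …, p - 1`. -/
def centralWord (X : ShiftSpace n) (p : ℕ) (x : X.Pt) : Fin (2 * p) → Fin n :=
  fun l => x.1 ((l : ℕ) - p)

theorem centralWord_eq_iff {p : ℕ} {x y : X.Pt} :
    X.centralWord p x = X.centralWord p y ↔ ∀ i : ℤ, -p ≤ i → i < p → x.1 i = y.1 i := by
  refine ⟨fun h i hpi hip => ?_, fun h => funext fun l => h _ (by omega) (by omega)⟩
  have hl := congrFun h ⟨(i + p).toNat, by omega⟩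
  rwa [centralWord, centralWord, Int.toNat_of_nonneg (by omega : 0 ≤ i + p),
    add_sub_cancel_right] at hl

theorem centralWord_shiftMap_iterate (p : ℕ) (x : X.Pt) :
    X.centralWord p (X.shiftMap^[p] x) = X.headWord (2 * p) x := by
  funext l
  rw [centralWord, shiftMap_iterate_apply, sub_add_cancel, headWord]

theorem continuous_centralWord (X : ShiftSpace n) (p : ℕ) : Continuous (X.centralWord p) :=
  continuous_pi fun _ => continuous_apply _

theorem measureReal_centralWord_preimage (hμ : MeasurePreserving X.shiftMap μ μ) (p : ℕ)
    (S : Set (Fin (2 * p) → Fin n)) :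
    μ.real (X.centralWord p ⁻¹' S) = μ.real (X.headWord (2 * p) ⁻¹' S) := by
  have hS : MeasurableSet (X.centralWord p ⁻¹' S) :=
    (X.continuous_centralWord p).measurable S.toFinite.measurableSet
  rw [← (hμ.iterate p).measureReal_preimage hS.nullMeasurableSet, ← Set.preimage_comp]
  simp only [Function.comp_def, centralWord_shiftMap_iterate]

/-- The points that agree on `{-p, …, p - 1}` with a point of `K`. -/
def thickening (X : ShiftSpace n) (p : ℕ) (K : Set X.Pt) : Set X.Pt :=
  X.centralWord p ⁻¹' (X.centralWord p '' K)

theorem subset_thickening (p : ℕ) (K : Set X.Pt) : K ⊆ X.thickening p K :=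
  Set.subset_preimage_image _ _

theorem measurableSet_thickening (X : ShiftSpace n) (p : ℕ) (K : Set X.Pt) :
    MeasurableSet (X.thickening p K) :=
  (X.continuous_centralWord p).measurable (Set.toFinite _).measurableSet

theorem antitone_thickening (K : Set X.Pt) : Antitone fun p => X.thickening p K := by
  rintro p q hpq y ⟨x, hx, hxy⟩
  rw [centralWord_eq_iff] at hxy
  exact ⟨x, hx, centralWord_eq_iff.2 fun i h₁ h₂ => hxy i (by omega) (by omega)⟩

theorem iInter_thickening {K : Set X.Pt} (hK : IsClosed K) : ⋂ p, X.thickening p K = K := by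
  refine Set.Subset.antisymm (fun y hy => ?_) (Set.subset_iInter fun p => subset_thickening p K)
  rw [Set.mem_iInter] at hy
  choose x hxK hxy using hy
  refine hK.mem_of_tendsto (f := x) (b := atTop) ?_ (Eventually.of_forall hxK)
  refine tendsto_subtype_rng.2 (tendsto_pi_nhds.2 fun i => tendsto_const_nhds.congr' ?_)
  filter_upwards [eventually_gt_atTop i.natAbs] with p hp
  exact (centralWord_eq_iff.1 (hxy p) i (by omega) (by omega)).symm

theorem tendsto_measureReal_thickening (μ : Measure X.Pt) [IsFiniteMeasure μ] {K : Set X.Pt}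
    (hK : IsClosed K) :
    Tendsto (fun p => μ.real (X.thickening p K)) atTop (𝓝 (μ.real K)) := by
  have h := tendsto_measure_iInter_atTop (μ := μ)
    (fun p => (X.measurableSet_thickening p K).nullMeasurableSet) (antitone_thickening K)
    ⟨0, measure_ne_top _ _⟩
  rw [iInter_thickening hK] at h
  exact (ENNReal.tendsto_toReal (measure_ne_top _ _)).comp h

namespace IsGibbs

variable {ν : Measure X.Pt} {c C : ℝ}

theorem upper_pos (hX : X.IsSubshift) (hν : X.IsGibbs ν c C) : 0 < C := by
  obtain ⟨x⟩ := hX.nonempty_pt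
  have h := (mul_pos hν.pos (Real.exp_pos _)).trans_le
    ((hν.le_measure 0 x).trans (hν.measure_le 0 x))
  exact pos_of_mul_pos_left h (Real.exp_pos _).le

theorem le_measureReal_fiber (hν : X.IsGibbs ν c C) {k : ℕ} {w : Fin k → Fin n}
    (hw : w ∈ Set.range (X.headWord k)) :
    c * Real.exp (-(X.entropy * k)) ≤ ν.real (X.headWord k ⁻¹' {w}) := by
  obtain ⟨x, rfl⟩ := hw
  rw [← cylinder_eq_preimage]
  exact hν.le_measure k x

theorem measureReal_inter_le (hX : X.HasBoundedGaps N) (hν : X.IsGibbs ν c C)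
    [IsFiniteMeasure ν] (k : ℕ) (x y : X.Pt) : ∃ g : Fin (N + 1),
    c * Real.exp (-(X.entropy * N)) * (ν.real (X.cylinder (X.headWord k x)) *
      ν.real (X.cylinder (X.headWord k y))) ≤
    C ^ 2 * ν.real (X.cylinder (X.headWord k x) ∩
      X.shiftMap^[k + g] ⁻¹' X.cylinder (X.headWord k y)) := by
  obtain ⟨g, z, hzx, hzy⟩ := hX.glue_at x y k
  have hsub : X.cylinder (X.headWord (k + g + k) z) ⊆ X.cylinder (X.headWord k x) ∩
      X.shiftMap^[k + (g : ℕ)] ⁻¹' X.cylinder (X.headWord k y) := by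
    intro t ht
    simp only [Set.mem_inter_iff, Set.mem_preimage, mem_cylinder_headWord,
      shiftMap_iterate_apply] at ht ⊢
    refine ⟨fun i h0 hi => ?_, fun i h0 hi => ?_⟩
    · rw [ht i h0 (by omega), hzx i hi]
    · rw [ht _ (by omega) (by omega), ← hzy i h0]
      push_cast
      ring_nf
  have hg : ((g : ℕ) : ℝ) ≤ N := by exact_mod_cast Nat.lt_succ_iff.1 g.2
  have hC := hν.upper_pos hX.toIsSubshift
  have hc := hν.pos
  have hh := hX.entropy_nonneg
  refine ⟨g, ?_⟩
  calc c * Real.exp (-(X.entropy * N)) * (ν.real (X.cylinder (X.headWord k x)) *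
      ν.real (X.cylinder (X.headWord k y)))
      ≤ c * Real.exp (-(X.entropy * N)) *
        ((C * Real.exp (-(X.entropy * k))) * (C * Real.exp (-(X.entropy * k)))) := by
        gcongr
        · exact hν.measure_le k x
        · exact hν.measure_le k y
    _ = C ^ 2 * (c * Real.exp (-(X.entropy * (k + N + k)))) := by
        rw [show -(X.entropy * ((k : ℝ) + N + k)) =
          -(X.entropy * k) + -(X.entropy * N) + -(X.entropy * k) by ring, Real.exp_add,
          Real.exp_add]
        ring
    _ ≤ C ^ 2 * (c * Real.exp (-(X.entropy * (k + g + k : ℕ)))) := by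
        push_cast
        gcongr
    _ ≤ _ := by
        gcongr
        exact (hν.le_measure _ z).trans (measureReal_mono hsub)

theorem mul_le_sum_measureReal_fiber_inter (hX : X.HasBoundedGaps N) (hν : X.IsGibbs ν c C)
    [IsFiniteMeasure ν] {k : ℕ} (u v : Fin k → Fin n) :
    c * Real.exp (-(X.entropy * N)) * (ν.real (X.headWord k ⁻¹' {u}) *
      ν.real (X.headWord k ⁻¹' {v})) ≤
    ∑ g : Fin (N + 1), C ^ 2 * ν.real (X.headWord k ⁻¹' {u} ∩
      X.shiftMap^[k + g] ⁻¹' (X.headWord k ⁻¹' {v})) := by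
  have hnonneg : ∀ g ∈ Finset.univ, 0 ≤ C ^ 2 * ν.real (X.headWord k ⁻¹' {u} ∩
      X.shiftMap^[k + (g : Fin (N + 1))] ⁻¹' (X.headWord k ⁻¹' {v})) := fun _ _ => by positivity
  rcases Set.eq_empty_or_nonempty (X.headWord k ⁻¹' {u}) with hu | ⟨x, rfl⟩
  · simpa only [hu, measureReal_empty, zero_mul, mul_zero] using Finset.sum_nonneg hnonneg
  rcases Set.eq_empty_or_nonempty (X.headWord k ⁻¹' {v}) with hv | ⟨y, rfl⟩
  · simpa only [hv, measureReal_empty, mul_zero] using Finset.sum_nonneg hnonneg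
  obtain ⟨g, hg⟩ := hν.measureReal_inter_le hX k x y
  simp only [cylinder_eq_preimage] at hg
  exact hg.trans (Finset.single_le_sum hnonneg (Finset.mem_univ g))

theorem mul_le_sum_measureReal_inter (hX : X.HasBoundedGaps N) (hν : X.IsGibbs ν c C)
    [IsFiniteMeasure ν] {k : ℕ} (S S' : Finset (Fin k → Fin n)) :
    c * Real.exp (-(X.entropy * N)) * (ν.real (X.headWord k ⁻¹' S) *
      ν.real (X.headWord k ⁻¹' S')) ≤
    ∑ g : Fin (N + 1), C ^ 2 * ν.real (X.headWord k ⁻¹' S ∩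
      X.shiftMap^[k + g] ⁻¹' (X.headWord k ⁻¹' S')) := by
  have hk := X.measurable_headWord k
  have fibers := fun S : Finset (Fin k → Fin n) =>
    sum_measureReal_preimage_singleton (μ := ν) S fun w _ => hk (measurableSet_singleton w)
  have pairs : ∀ g, ν.real (X.headWord k ⁻¹' S ∩
      X.shiftMap^[k + g] ⁻¹' (X.headWord k ⁻¹' S')) = ∑ u ∈ S, ∑ v ∈ S',
      ν.real (X.headWord k ⁻¹' {u} ∩ X.shiftMap^[k + g] ⁻¹' (X.headWord k ⁻¹' {v})) := by
    intro g
    have h := sum_measureReal_preimage_singleton (μ := ν) (S ×ˢ S')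
      fun w _ => (hk.prodMk (hk.comp (X.measurable_iterate_shiftMap (k + g))))
        (measurableSet_singleton w)
    simp only [Finset.coe_product, Set.mk_preimage_prod, ← Set.singleton_prod_singleton,
      Finset.sum_product] at h
    exact h.symm
  rw [← fibers, ← fibers, Finset.sum_mul_sum, ← Finset.sum_product', Finset.mul_sum]
  simp only [pairs, ← Finset.sum_product', Finset.mul_sum]
  rw [Finset.sum_product_right (s := (Finset.univ : Finset (Fin (N + 1))))]
  exact Finset.sum_le_sum fun w _ => hν.mul_le_sum_measureReal_fiber_inter hX w.1 w.2

theorem mul_le_sum_measureReal_thickening_inter (hX : X.HasBoundedGaps N)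
    (hν : X.IsGibbs ν c C) [IsFiniteMeasure ν] (p : ℕ) (K K' : Set X.Pt) :
    c * Real.exp (-(X.entropy * N)) * (ν.real (X.thickening p K) *
      ν.real (X.thickening p K')) ≤
    ∑ g : Fin (N + 1), C ^ 2 * ν.real (X.thickening p K ∩
      X.shiftMap^[2 * p + g] ⁻¹' X.thickening p K') := by
  have words : ∀ F : Set X.Pt, X.shiftMap^[p] ⁻¹' X.thickening p F =
      X.headWord (2 * p) ⁻¹' (Set.toFinite (X.centralWord p '' F)).toFinset := fun F => by
    simp only [thickening, ← Set.preimage_comp, Function.comp_def, centralWord_shiftMap_iterate,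
      Set.Finite.coe_toFinset]
  have shifted : ∀ E : Set X.Pt, MeasurableSet E → ν.real (X.shiftMap^[p] ⁻¹' E) = ν.real E :=
    fun E hE => (hν.measurePreserving.iterate p).measureReal_preimage hE.nullMeasurableSet
  have hE := fun F : Set X.Pt => X.measurableSet_thickening p F
  have h := hν.mul_le_sum_measureReal_inter hX (Set.toFinite (X.centralWord p '' K)).toFinset
    (Set.toFinite (X.centralWord p '' K')).toFinset
  simp only [← words, shifted _ (hE _), ← Set.preimage_comp, ← Function.iterate_add] at h
  simp only [add_comm p, Function.iterate_add _ _ p, Set.preimage_comp, ← Set.preimage_inter] at h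
  simpa only [shifted _ ((hE K).inter (X.measurable_iterate_shiftMap _ (hE K')))] using h

theorem ergodic (hX : X.HasBoundedGaps N) (hν : X.IsGibbs ν c C) [IsFiniteMeasure ν] :
    Ergodic X.shiftMap ν := by
  refine ⟨hν.measurePreserving, ⟨fun A hA hinv => ?_⟩⟩
  by_contra hcon
  rw [eventuallyConst_set', not_or, ae_eq_empty, ae_eq_univ] at hcon
  obtain ⟨K, hKA, hK, hK0⟩ := hA.exists_lt_isClosed_of_ne_top (measure_ne_top _ _)
    (pos_iff_ne_zero.2 hcon.1)
  obtain ⟨K', hKA', hK', hK0'⟩ := hA.compl.exists_lt_isClosed_of_ne_top (measure_ne_top _ _)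
    (pos_iff_ne_zero.2 hcon.2)
  have hpos : 0 < ν.real K := ENNReal.toReal_pos hK0.ne' (measure_ne_top _ _)
  have hpos' : 0 < ν.real K' := ENNReal.toReal_pos hK0'.ne' (measure_ne_top _ _)
  have hbound : ∀ p, c * Real.exp (-(X.entropy * N)) * (ν.real K * ν.real K') ≤
      ∑ g : Fin (N + 1), C ^ 2 * ((ν.real (X.thickening p K) - ν.real K) +
        (ν.real (X.thickening p K') - ν.real K')) := by
    intro p
    have hc := hν.pos
    refine le_trans ?_ ((hν.mul_le_sum_measureReal_thickening_inter hX p K K').trans ?_)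
    · gcongr ?_ * (?_ * ?_)
      · exact measureReal_mono (subset_thickening p K)
      · exact measureReal_mono (subset_thickening p K')
    · gcongr
      exact measureReal_inter_preimage_le (hν.measurePreserving.iterate _)
        (Function.IsFixedPt.preimage_iterate hinv _) hKA hKA' hK.measurableSet hK'.measurableSet
        (subset_thickening p K) (subset_thickening p K') (X.measurableSet_thickening p K')
  have hlim := tendsto_finsetSum Finset.univ fun (_ : Fin (N + 1)) _ =>
    (((tendsto_measureReal_thickening ν hK).sub_const (ν.real K)).add
      ((tendsto_measureReal_thickening ν hK').sub_const (ν.real K'))).const_mul (C ^ 2)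
  simp only [sub_self, add_zero, mul_zero, Finset.sum_const_zero] at hlim
  exact (ge_of_tendsto' hlim hbound).not_gt
    (mul_pos (mul_pos hν.pos (Real.exp_pos _)) (mul_pos hpos hpos'))

theorem entropy_mul_sub_log_le (hX : X.IsSubshift) (hν : X.IsGibbs ν c C)
    [IsProbabilityMeasure ν] (k : ℕ) :
    X.entropy * k - Real.log C ≤ shannonEntropy ν (X.headWord k) := by
  have hC := hν.upper_pos hX
  have hterm : ∀ w, ν.real (X.headWord k ⁻¹' {w}) * (X.entropy * k - Real.log C) ≤
      Real.negMulLog (ν.real (X.headWord k ⁻¹' {w})) := by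
    intro w
    rcases Set.eq_empty_or_nonempty (X.headWord k ⁻¹' {w}) with hw | ⟨x, rfl⟩
    · simp [hw]
    have hpos : 0 < ν.real (X.headWord k ⁻¹' {X.headWord k x}) :=
      (mul_pos hν.pos (Real.exp_pos _)).trans_le (hν.le_measureReal_fiber ⟨x, rfl⟩)
    have hlog := Real.log_le_log hpos (cylinder_eq_preimage (X.headWord k x) ▸ hν.measure_le k x)
    rw [Real.log_mul hC.ne' (Real.exp_pos _).ne', Real.log_exp] at hlog
    rw [Real.negMulLog, neg_mul, ← mul_neg]
    gcongr
    linarith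
  have hsum := Finset.sum_le_sum fun w (_ : w ∈ Finset.univ) => hterm w
  rwa [← Finset.sum_mul, sum_measureReal_preimage_singleton _ fun w _ =>
    X.measurable_headWord k (measurableSet_singleton w), Finset.coe_univ, Set.preimage_univ,
    probReal_univ, one_mul] at hsum

theorem mem_maxMeasures {ν : ProbabilityMeasure X.Pt} (hX : X.IsSubshift)
    (hν : X.IsGibbs ν c C) : ν ∈ X.maxMeasures := by
  refine ⟨hν.measurePreserving, le_antisymm (hX.measureEntropy_le hν.measurePreserving) ?_⟩
  have hlim : Tendsto (fun k : ℕ => X.entropy - Real.log C / k) atTop (𝓝 (X.entropy - 0)) :=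
    tendsto_const_nhds.sub (tendsto_const_div_atTop_nhds_zero_nat _)
  rw [sub_zero] at hlim
  refine le_of_tendsto_of_tendsto hlim (tendsto_measureEntropy hν.measurePreserving) ?_
  filter_upwards [eventually_gt_atTop 0] with k hk
  have hk' : (0 : ℝ) < k := by exact_mod_cast hk
  rw [le_div_iff₀ hk', sub_mul, div_mul_cancel₀ _ hk'.ne']
  exact hν.entropy_mul_sub_log_le hX k

theorem card_mul_le_measureReal (hν : X.IsGibbs ν c C) [IsFiniteMeasure ν] {k : ℕ}
    {S : Finset (Fin k → Fin n)} (hS : ↑S ⊆ Set.range (X.headWord k)) :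
    S.card * (c * Real.exp (-(X.entropy * k))) ≤ ν.real (X.headWord k ⁻¹' S) := by
  rw [← sum_measureReal_preimage_singleton S fun w _ =>
    X.measurable_headWord k (measurableSet_singleton w), ← nsmul_eq_mul]
  exact Finset.card_nsmul_le_sum S _ _ fun w hw => hν.le_measureReal_fiber (hS hw)

theorem measureReal_mul_log_card_le (hν : X.IsGibbs ν c C) [IsFiniteMeasure ν]
    (μ : Measure X.Pt) {k : ℕ} {S : Finset (Fin k → Fin n)}
    (hS : ↑S ⊆ Set.range (X.headWord k)) :
    μ.real (X.headWord k ⁻¹' S) * Real.log S.card ≤ μ.real (X.headWord k ⁻¹' S) *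
      (X.entropy * k - Real.log c + Real.log (ν.real (X.headWord k ⁻¹' S))) := by
  rcases S.eq_empty_or_nonempty with rfl | hne
  · simp
  have hcard : (0 : ℝ) < S.card := by exact_mod_cast hne.card_pos
  have hc := hν.pos
  have hlog := Real.log_le_log (by positivity) (hν.card_mul_le_measureReal hS)
  rw [Real.log_mul hcard.ne' (by positivity), Real.log_mul hc.ne' (Real.exp_pos _).ne',
    Real.log_exp] at hlog
  gcongr
  linarith

theorem shannonEntropy_le (hν : X.IsGibbs ν c C) [IsProbabilityMeasure ν]
    (μ : Measure X.Pt) [IsProbabilityMeasure μ] {k : ℕ} {S : Finset (Fin k → Fin n)}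
    (hS : ↑S ⊆ Set.range (X.headWord k)) :
    shannonEntropy μ (X.headWord k) ≤ Real.log 2 + X.entropy * k - Real.log c +
      μ.real (X.headWord k ⁻¹' S) * Real.log (ν.real (X.headWord k ⁻¹' S)) := by
  classical
  have hk := X.measurable_headWord k
  let W := (Set.toFinite (Set.range (X.headWord k))).toFinset
  have hW : ∀ x, X.headWord k x ∈ W := fun x => by simp [W]
  have hSW : S ⊆ W := fun w hw => by simpa [W] using hS hw
  have hsplit := shannonEntropy_le_log_two_add (μ := μ) hk hW hSW
  have hin := hν.measureReal_mul_log_card_le μ hS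
  have hout := hν.measureReal_mul_log_card_le μ (S := W \ S) fun w hw => by
    simp only [Finset.coe_sdiff, W, Set.Finite.coe_toFinset] at hw
    exact hw.1
  have htotal : μ.real (X.headWord k ⁻¹' (W \ S : Finset _)) = 1 - μ.real (X.headWord k ⁻¹' S) := by
    have hcompl : X.headWord k ⁻¹' (W \ S : Finset _) = (X.headWord k ⁻¹' S)ᶜ := by
      ext x
      simp [hW x]
    rw [hcompl, probReal_compl_eq_one_sub (hk S.measurableSet)]
  have hneg : μ.real (X.headWord k ⁻¹' (W \ S : Finset _)) *
      Real.log (ν.real (X.headWord k ⁻¹' (W \ S : Finset _))) ≤ 0 :=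
    mul_nonpos_of_nonneg_of_nonpos measureReal_nonneg
      (Real.log_nonpos measureReal_nonneg measureReal_le_one)
  rw [mul_add] at hin hout
  rw [htotal] at hout hsplit hneg
  linarith

theorem exp_le_measureReal_thickening (hX : X.IsSubshift) (hν : X.IsGibbs ν c C)
    [IsProbabilityMeasure ν] {μ : ProbabilityMeasure X.Pt} (hμ : μ ∈ X.maxMeasures)
    {K : Set X.Pt} (hK : 0 < (μ : Measure X.Pt).real K) (p : ℕ) :
    Real.exp ((Real.log c - Real.log 2) / (μ : Measure X.Pt).real K) ≤
      ν.real (X.thickening p K) := by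
  obtain ⟨x, hx⟩ := nonempty_of_measureReal_ne_zero hK.ne'
  let S := (Set.toFinite (X.centralWord p '' K)).toFinset
  have hS : ↑S ⊆ Set.range (X.headWord (2 * p)) := by
    simp only [S, Set.Finite.coe_toFinset]
    rintro _ ⟨y, -, rfl⟩
    exact ⟨hX.translate (-p) y, rfl⟩
  have mass : ∀ {m : Measure X.Pt}, MeasurePreserving X.shiftMap m m →
      m.real (X.headWord (2 * p) ⁻¹' S) = m.real (X.thickening p K) := fun hm => by
    rw [← measureReal_centralWord_preimage hm, thickening, Set.Finite.coe_toFinset]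
  have hcard : 0 < S.card :=
    Finset.card_pos.2 ⟨_, (Set.Finite.mem_toFinset _).2 (Set.mem_image_of_mem _ hx)⟩
  have hlower := hν.card_mul_le_measureReal hS
  have hupper := hν.shannonEntropy_le μ hS
  have hentropy := measureEntropy_mul_le hμ.1 (2 * p)
  rw [mass hν.measurePreserving] at hlower hupper
  rw [mass hμ.1] at hupper
  rw [hμ.2] at hentropy
  have hc := hν.pos
  have hpos : 0 < ν.real (X.thickening p K) := lt_of_lt_of_le (by positivity) hlower
  rw [← Real.le_log_iff_exp_le hpos, div_le_iff₀' hK]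
  calc Real.log c - Real.log 2
      ≤ (μ : Measure X.Pt).real (X.thickening p K) * Real.log (ν.real (X.thickening p K)) := by
        linarith
    _ ≤ _ := mul_le_mul_of_nonpos_right (measureReal_mono (subset_thickening p K))
        (Real.log_nonpos hpos.le measureReal_le_one)

theorem absolutelyContinuous (hX : X.IsSubshift) (hν : X.IsGibbs ν c C)
    [IsProbabilityMeasure ν] {μ : ProbabilityMeasure X.Pt} (hμ : μ ∈ X.maxMeasures) :
    (μ : Measure X.Pt) ≪ ν := by
  refine Measure.AbsolutelyContinuous.mk fun s hs hs0 => ?_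
  by_contra hcon
  obtain ⟨K, hKs, hK, hK0⟩ := hs.exists_lt_isClosed_of_ne_top (measure_ne_top _ _)
    (pos_iff_ne_zero.2 hcon)
  have hpos : 0 < (μ : Measure X.Pt).real K := ENNReal.toReal_pos hK0.ne' (measure_ne_top _ _)
  have hlim := tendsto_measureReal_thickening ν hK
  rw [measureReal_def, measure_mono_null hKs hs0, ENNReal.toReal_zero] at hlim
  exact (ge_of_tendsto' hlim fun p => hν.exp_le_measureReal_thickening hX hμ hpos p).not_gt
    (Real.exp_pos _)

theorem maxMeasures_eq {ν : ProbabilityMeasure X.Pt} (hX : X.HasBoundedGaps N)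
    (hν : X.IsGibbs ν c C) : X.maxMeasures = {ν} := by
  refine Set.Subset.antisymm (fun μ hμ => ?_)
    (Set.singleton_subset_iff.2 (hν.mem_maxMeasures hX.toIsSubshift))
  have h : (μ : Measure X.Pt) = ν :=
    (hν.ergodic hX).eq_of_absolutelyContinuous hμ.1 (hν.absolutelyContinuous hX.toIsSubshift hμ)
  exact Subtype.ext h

end IsGibbs

end ShiftSpace

/-! ### Hausdorff dimension -/

open scoped ENNReal NNReal

section DimH

variable {E : Type*} [EMetricSpace E] [MeasurableSpace E] [BorelSpace E] {s : Set E} {d : ℝ≥0}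

theorem dimH_le_of_sum_ediam_rpow_le {ι : ℕ → Type*} [∀ p, Fintype (ι p)] {r : ℕ → ℝ≥0∞}
    (hr : Tendsto r atTop (𝓝 0)) {t : ∀ p, ι p → Set E} (ht : ∀ p i, Metric.ediam (t p i) ≤ r p)
    (hst : ∀ p, s ⊆ ⋃ i, t p i) {B : ℝ≥0∞} (hB : B ≠ ⊤)
    (hsum : ∀ p, ∑ i, Metric.ediam (t p i) ^ (d : ℝ) ≤ B) : dimH s ≤ d := by
  refine dimH_le_of_hausdorffMeasure_ne_top (ne_top_of_le_ne_top hB ?_)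
  calc Measure.hausdorffMeasure d s
      ≤ liminf (fun p => ∑ i, Metric.ediam (t p i) ^ (d : ℝ)) atTop :=
        Measure.hausdorffMeasure_le_liminf_sum d s r hr t (Eventually.of_forall ht)
          (Eventually.of_forall hst)
    _ ≤ liminf (fun _ : ℕ => B) atTop := liminf_le_liminf (Eventually.of_forall hsum)
    _ = B := liminf_const B

/-- The mass distribution principle. -/
theorem le_dimH_of_measure_le_ediam_rpow {μ : Measure E} (hμ : μ s ≠ 0) {M r : ℝ≥0∞}
    (hM : M ≠ ⊤) (hr : 0 < r)
    (h : ∀ t, IsClosed t → Metric.ediam t ≤ r → μ t ≤ M * Metric.ediam t ^ (d : ℝ)) :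
    d ≤ dimH s := by
  have hle : M⁻¹ • μ ≤ Measure.hausdorffMeasure d := by
    refine Measure.le_hausdorffMeasure d _ r hr fun t ht => ?_
    rw [← Metric.ediam_closure] at ht ⊢
    calc (M⁻¹ • μ) t ≤ M⁻¹ * μ (closure t) := by
          rw [Measure.smul_apply, smul_eq_mul]
          gcongr
          exact subset_closure
      _ = μ (closure t) / M := by rw [ENNReal.div_eq_inv_mul]
      _ ≤ Metric.ediam (closure t) ^ (d : ℝ) :=
          ENNReal.div_le_of_le_mul' (h _ isClosed_closure ht)
  refine le_dimH_of_hausdorffMeasure_ne_zero (ne_of_gt (lt_of_lt_of_le ?_ (hle s)))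
  exact ENNReal.mul_pos (ENNReal.inv_ne_zero.2 hM) hμ

end DimH

theorem tsum_le_of_le_geometric {r : ℝ} (hr₀ : 0 ≤ r) (hr₁ : r < 1) {p : ℕ} {g : ℕ → ℝ≥0∞}
    (hzero : ∀ j < p, g j = 0) (hg : ∀ j, g j ≤ ENNReal.ofReal (r ^ j)) :
    ∑' j, g j ≤ ENNReal.ofReal ((1 - r)⁻¹ * r ^ p) := by
  have hsum : HasSum (fun j => r ^ (j + p)) ((1 - r)⁻¹ * r ^ p) := by
    simp only [pow_add]
    exact (hasSum_geometric_of_lt_one hr₀ hr₁).mul_right _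
  calc ∑' j, g j = ∑' j, g (j + p) := by
        rw [← ENNReal.summable.sum_add_tsum_nat_add' (k := p),
          Finset.sum_eq_zero fun j hj => hzero j (Finset.mem_range.1 hj), zero_add]
    _ ≤ ∑' j, ENNReal.ofReal (r ^ (j + p)) := ENNReal.tsum_le_tsum fun j => hg _
    _ = _ := by
        rw [← ENNReal.ofReal_tsum_of_nonneg (fun j => by positivity) hsum.summable, hsum.tsum_eq]

theorem tsum_int_le_of_le_geometric {r : ℝ} (hr₀ : 0 ≤ r) (hr₁ : r < 1) {p : ℕ} {f : ℤ → ℝ≥0∞}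
    (hzero : ∀ i : ℤ, -p ≤ i → i < p → f i = 0)
    (hf : ∀ i, f i ≤ ENNReal.ofReal (r ^ i.natAbs)) :
    ∑' i, f i ≤ ENNReal.ofReal (2 * (1 - r)⁻¹ * r ^ p) := by
  have : 0 ≤ (1 - r)⁻¹ := inv_nonneg.2 (by linarith)
  have htails := HasSum.of_nat_of_neg_add_one (f := f) ENNReal.summable.hasSum
    ENNReal.summable.hasSum
  rw [htails.tsum_eq, mul_assoc, two_mul, ENNReal.ofReal_add (by positivity) (by positivity)]
  refine add_le_add
    (tsum_le_of_le_geometric hr₀ hr₁ (fun j hj => hzero _ (by omega) (by omega)) fun j => hf j)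
    (tsum_le_of_le_geometric hr₀ hr₁ (fun j hj => hzero _ (by omega) (by omega)) fun j => ?_)
  refine (hf _).trans (ENNReal.ofReal_le_ofReal ?_)
  exact pow_le_pow_of_le_one hr₀ hr₁.le (by omega)

namespace ShiftSpace

variable {n : ℕ} {X : ShiftSpace n} {N : ℕ}

/-- The full shift as a metric space; a type synonym, because `ℤ → Fin n` itself carries the
product structures. -/
def MetricShift (n : ℕ) : Type := ℤ → Fin n

noncomputable instance (n : ℕ) : EMetricSpace (MetricShift n) := fullShiftMetric n

noncomputable instance (n : ℕ) : MeasurableSpace (MetricShift n) := borel _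

instance (n : ℕ) : BorelSpace (MetricShift n) := ⟨rfl⟩

/-- The inclusion of a shift space into the full shift with its metric. -/
def toMetricShift (X : ShiftSpace n) (x : X.Pt) : MetricShift n := x.1

theorem dim_eq_dimH_range (X : ShiftSpace n) : X.dim = dimH (Set.range X.toMetricShift) :=
  congrArg (dimH (X := MetricShift n)) Subtype.range_coe.symm

theorem edist_toMetricShift (x y : X.Pt) :
    edist (X.toMetricShift x) (X.toMetricShift y) = ∑' i : ℤ,
      ENNReal.ofReal (|((x.1 i : ℕ) : ℝ) - ((y.1 i : ℕ) : ℝ)| / (n : ℝ) ^ (i.natAbs + 1)) := rfl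

theorem edist_le_of_centralWord_eq (hn : 2 ≤ n) {x y : X.Pt} {p : ℕ}
    (h : X.centralWord p x = X.centralWord p y) :
    edist (X.toMetricShift x) (X.toMetricShift y) ≤ ENNReal.ofReal (4 * ((n : ℝ)⁻¹) ^ p) := by
  have hn₂ : (2 : ℝ) ≤ n := by exact_mod_cast hn
  have hinv : (n : ℝ)⁻¹ ≤ 2⁻¹ := inv_anti₀ (by norm_num) hn₂
  have hratio : (1 - (n : ℝ)⁻¹)⁻¹ ≤ 2 := by
    rw [inv_le_comm₀ (by linarith) (by norm_num)]
    linarith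
  rw [centralWord_eq_iff] at h
  rw [edist_toMetricShift]
  refine (tsum_int_le_of_le_geometric (r := (n : ℝ)⁻¹) (p := p) (by positivity) (by linarith)
    (fun i hi hi' => by simp [h i hi hi']) fun i => ENNReal.ofReal_le_ofReal ?_).trans
    (ENNReal.ofReal_le_ofReal ?_)
  · have hx : ((x.1 i : ℕ) : ℝ) ≤ n := by exact_mod_cast (x.1 i).2.le
    have hy : ((y.1 i : ℕ) : ℝ) ≤ n := by exact_mod_cast (y.1 i).2.le
    rw [div_le_iff₀ (by positivity), inv_pow, pow_succ, inv_mul_cancel_left₀ (by positivity)]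
    exact abs_sub_le_of_nonneg_of_le (Nat.cast_nonneg _) hx (Nat.cast_nonneg _) hy
  · gcongr
    linarith

theorem centralWord_eq_of_edist_lt {x y : X.Pt} {p : ℕ}
    (h : edist (X.toMetricShift x) (X.toMetricShift y) < ENNReal.ofReal (((n : ℝ)⁻¹) ^ (p + 1))) :
    X.centralWord p x = X.centralWord p y := by
  refine centralWord_eq_iff.2 fun i hi hi' => ?_
  by_contra hne
  refine h.not_ge ?_
  have hn : (1 : ℝ) ≤ n := by exact_mod_cast Fin.pos (x.1 i)
  have hdiff : (1 : ℝ) ≤ |((x.1 i : ℕ) : ℝ) - ((y.1 i : ℕ) : ℝ)| := by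
    have : (1 : ℤ) ≤ |((x.1 i : ℕ) : ℤ) - ((y.1 i : ℕ) : ℤ)| :=
      Int.one_le_abs (sub_ne_zero.2 fun h => hne (Fin.ext (by exact_mod_cast h)))
    exact_mod_cast this
  rw [edist_toMetricShift]
  refine (ENNReal.ofReal_le_ofReal ?_).trans (ENNReal.le_tsum i)
  rw [inv_pow, ← one_div]
  gcongr
  omega

theorem tendsto_ofReal_const_mul_inv_pow (hn : 2 ≤ n) (a : ℝ) :
    Tendsto (fun p : ℕ => ENNReal.ofReal (a * ((n : ℝ)⁻¹) ^ p)) atTop (𝓝 0) := by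
  have hn₁ : (1 : ℝ) < n := by exact_mod_cast hn
  have h := (tendsto_pow_atTop_nhds_zero_of_lt_one (r := (n : ℝ)⁻¹) (by positivity)
    (inv_lt_one_of_one_lt₀ hn₁)).const_mul a
  simpa only [mul_zero, ENNReal.ofReal_zero] using ENNReal.tendsto_ofReal h

theorem continuous_toMetricShift (hn : 2 ≤ n) (X : ShiftSpace n) : Continuous X.toMetricShift := by
  refine continuous_iff_continuousAt.2 fun x => EMetric.tendsto_nhds.2 fun ε hε => ?_
  obtain ⟨p, hp⟩ :=
    ((tendsto_ofReal_const_mul_inv_pow hn 4).eventually (gt_mem_nhds hε)).exists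
  filter_upwards [((isOpen_discrete {X.centralWord p x}).preimage
    (X.continuous_centralWord p)).mem_nhds rfl] with y hy
  exact (edist_le_of_centralWord_eq hn hy).trans_lt hp

/-- With `d = 2 h / log n`, the `d`-th power of the diameter `n ^ (-p)` of a central cylinder
matches the mass `exp (-2 p h)` that a Gibbs measure gives it. -/
theorem inv_pow_rpow_eq_exp (hn : 2 ≤ n) (h : ℝ) (p : ℕ) :
    (((n : ℝ)⁻¹) ^ p) ^ (2 * h / Real.log n) = Real.exp (-(h * (2 * p))) := by
  have hn₁ : (1 : ℝ) < n := by exact_mod_cast hn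
  have hlog := Real.log_pos hn₁
  rw [Real.rpow_def_of_pos (by positivity), Real.log_pow, Real.log_inv]
  congr 1
  field_simp

theorem centralWord_mem_words (p : ℕ) (x : X.Pt) : X.centralWord p x ∈ X.words (2 * p) :=
  ⟨x.1, x.2, -p, fun l => by rw [centralWord, neg_add_eq_sub]⟩

theorem HasBoundedGaps.ncard_words_mul_rpow_le (hX : X.HasBoundedGaps N) (hn : 2 ≤ n) (p : ℕ) :
    (X.words (2 * p)).ncard * (4 * ((n : ℝ)⁻¹) ^ p) ^ (2 * X.entropy / Real.log n) ≤
      gapConst n N * 4 ^ (2 * X.entropy / Real.log n) := by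
  have hwords := hX.ncard_words_le_exp (2 * p)
  push_cast at hwords
  rw [Real.mul_rpow (by norm_num) (by positivity), inv_pow_rpow_eq_exp hn]
  calc (X.words (2 * p)).ncard *
        (4 ^ (2 * X.entropy / Real.log n) * Real.exp (-(X.entropy * (2 * p))))
      ≤ (gapConst n N * Real.exp (X.entropy * (2 * p))) *
        (4 ^ (2 * X.entropy / Real.log n) * Real.exp (-(X.entropy * (2 * p)))) := by gcongr
    _ = _ := by
        rw [Real.exp_neg]
        field_simp

theorem HasBoundedGaps.dim_le (hX : X.HasBoundedGaps N) (hn : 2 ≤ n) :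
    X.dim ≤ ENNReal.ofReal (2 * X.entropy / Real.log n) := by
  classical
  have hh := hX.entropy_nonneg
  have hd : 0 ≤ 2 * X.entropy / Real.log n := by positivity
  let t : ∀ p : ℕ, X.words (2 * p) → Set (MetricShift n) := fun p w =>
    X.toMetricShift '' (X.centralWord p ⁻¹' {w.1})
  have hdiam : ∀ p w, Metric.ediam (t p w) ≤ ENNReal.ofReal (4 * ((n : ℝ)⁻¹) ^ p) := by
    intro p w
    refine Metric.ediam_le ?_
    rintro _ ⟨x, hx, rfl⟩ _ ⟨y, hy, rfl⟩
    exact edist_le_of_centralWord_eq hn (hx.trans hy.symm)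
  have hcover : ∀ p, Set.range X.toMetricShift ⊆ ⋃ w, t p w := by
    rintro p _ ⟨x, rfl⟩
    exact Set.mem_iUnion.2 ⟨⟨_, centralWord_mem_words p x⟩, x, rfl, rfl⟩
  rw [dim_eq_dimH_range]
  refine dimH_le_of_sum_ediam_rpow_le (tendsto_ofReal_const_mul_inv_pow hn 4) hdiam hcover
    (B := ENNReal.ofReal (gapConst n N * 4 ^ (2 * X.entropy / Real.log n))) ENNReal.ofReal_ne_top
    fun p => ?_
  rw [Real.coe_toNNReal _ hd]
  refine (Finset.sum_le_card_nsmul _ _ _ fun w _ =>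
    ENNReal.rpow_le_rpow (hdiam p w) hd).trans ?_
  rw [ENNReal.ofReal_rpow_of_nonneg (by positivity) hd, nsmul_eq_mul, Finset.card_univ,
    ← Nat.card_eq_fintype_card, Nat.card_coe_set_eq, ← ENNReal.ofReal_natCast,
    ← ENNReal.ofReal_mul (Nat.cast_nonneg _)]
  exact ENNReal.ofReal_le_ofReal (hX.ncard_words_mul_rpow_le hn p)

namespace IsGibbs

variable {ν : Measure X.Pt} {c C : ℝ}

theorem measureReal_centralWord_fiber_le (hX : X.IsSubshift) (hν : X.IsGibbs ν c C) (p : ℕ)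
    (x : X.Pt) : ν.real (X.centralWord p ⁻¹' {X.centralWord p x}) ≤
      C * Real.exp (-(X.entropy * (2 * p))) := by
  have h := hν.measure_le (2 * p) (hX.translate (-p) x)
  push_cast [cylinder_eq_preimage] at h
  rwa [measureReal_centralWord_preimage hν.measurePreserving]

theorem measure_preimage_le (hX : X.IsSubshift) (hν : X.IsGibbs ν c C) [IsFiniteMeasure ν]
    {t : Set (MetricShift n)} {p : ℕ}
    (ht : Metric.ediam t < ENNReal.ofReal (((n : ℝ)⁻¹) ^ (p + 1))) :
    ν (X.toMetricShift ⁻¹' t) ≤ ENNReal.ofReal (C * Real.exp (-(X.entropy * (2 * p)))) := by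
  rcases (X.toMetricShift ⁻¹' t).eq_empty_or_nonempty with hempty | ⟨x, hx⟩
  · simp [hempty]
  have hsub : X.toMetricShift ⁻¹' t ⊆ X.centralWord p ⁻¹' {X.centralWord p x} := fun y hy =>
    centralWord_eq_of_edist_lt ((Metric.edist_le_ediam_of_mem (s := t) hy hx).trans_lt ht)
  rw [← ENNReal.ofReal_toReal (measure_ne_top ν _)]
  exact ENNReal.ofReal_le_ofReal
    ((measureReal_mono hsub).trans (hν.measureReal_centralWord_fiber_le hX p x))

theorem measure_preimage_eq_zero (hX : X.IsSubshift) (hν : X.IsGibbs ν c C) [IsFiniteMeasure ν]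
    (hh : 0 < X.entropy) {t : Set (MetricShift n)} (ht : Metric.ediam t = 0) :
    ν (X.toMetricShift ⁻¹' t) = 0 := by
  have hn : (0 : ℝ) < n := by exact_mod_cast hX.alphabet_pos
  have hexponent : Tendsto (fun p : ℕ => X.entropy * (2 * (p : ℝ))) atTop atTop :=
    (tendsto_natCast_atTop_atTop.const_mul_atTop two_pos).const_mul_atTop hh
  have hlim := ENNReal.tendsto_ofReal
    ((Real.tendsto_exp_neg_atTop_nhds_zero.comp hexponent).const_mul C)
  rw [mul_zero, ENNReal.ofReal_zero] at hlim
  refine nonpos_iff_eq_zero.1 (ge_of_tendsto' hlim fun p => hν.measure_preimage_le hX ?_)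
  rw [ht]
  exact ENNReal.ofReal_pos.2 (by positivity)

theorem measure_preimage_le_mul_rpow (hX : X.IsSubshift) (hν : X.IsGibbs ν c C)
    [IsFiniteMeasure ν] (hn : 2 ≤ n) {t : Set (MetricShift n)} {D : ℝ} (hD : 0 < D)
    (hDn : D ≤ ((n : ℝ)⁻¹) ^ 2) (ht : Metric.ediam t = ENNReal.ofReal D) :
    ν (X.toMetricShift ⁻¹' t) ≤
      ENNReal.ofReal (C * Real.exp (X.entropy * 6) * D ^ (2 * X.entropy / Real.log n)) := by
  have hn₁ : (1 : ℝ) < n := by exact_mod_cast hn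
  have hh := hX.entropy_nonneg
  have hC := hν.upper_pos hX
  have hinv₁ : (n : ℝ)⁻¹ < 1 := inv_lt_one_of_one_lt₀ hn₁
  have hinv₀ : 0 < (n : ℝ)⁻¹ := by positivity
  obtain ⟨q, hqD, hDq⟩ := exists_nat_pow_near_of_lt_one hD
    (hDn.trans (pow_le_one₀ hinv₀.le hinv₁.le)) hinv₀ hinv₁
  have hq : 2 < q + 1 := (pow_lt_pow_iff_right_of_lt_one₀ hinv₀ hinv₁).1 (hqD.trans_le hDn)
  obtain ⟨p, rfl⟩ := Nat.exists_eq_add_of_le (Nat.lt_succ_iff.1 hq)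
  have hcylinder := hν.measure_preimage_le hX (t := t) (p := p) <| by
    rw [ht, ENNReal.ofReal_lt_ofReal_iff (by positivity)]
    exact hDq.trans_lt ((pow_lt_pow_iff_right_of_lt_one₀ hinv₀ hinv₁).2 (by omega))
  refine hcylinder.trans (ENNReal.ofReal_le_ofReal ?_)
  calc C * Real.exp (-(X.entropy * (2 * p)))
      = C * Real.exp (X.entropy * 6) * Real.exp (-(X.entropy * (2 * (2 + p + 1 : ℕ)))) := by
        rw [mul_assoc, ← Real.exp_add]
        congr 2
        push_cast
        ring
    _ ≤ _ := by
        rw [← inv_pow_rpow_eq_exp hn]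
        gcongr

end IsGibbs

namespace HasBoundedGaps

theorem le_dim (hX : X.HasBoundedGaps N) (hn : 2 ≤ n) :
    ENNReal.ofReal (2 * X.entropy / Real.log n) ≤ X.dim := by
  have hn₁ : (1 : ℝ) < n := by exact_mod_cast hn
  have hlog := Real.log_pos hn₁
  rcases hX.entropy_nonneg.eq_or_lt with hh | hh
  · simp [← hh]
  have hd : 0 < 2 * X.entropy / Real.log n := by positivity
  obtain ⟨ν, c, C, hν⟩ := hX.exists_isGibbs
  have hC := hν.upper_pos hX.toIsSubshift
  have hι := (X.continuous_toMetricShift hn).measurable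
  rw [dim_eq_dimH_range]
  refine le_dimH_of_measure_le_ediam_rpow (μ := (ν : Measure X.Pt).map X.toMetricShift)
    (M := ENNReal.ofReal (C * Real.exp (X.entropy * 6))) (r := ENNReal.ofReal (((n : ℝ)⁻¹) ^ 2))
    ?_ ENNReal.ofReal_ne_top (ENNReal.ofReal_pos.2 (by positivity)) fun t ht hdiam => ?_
  · refine (lt_of_lt_of_le ?_ (Measure.le_map_apply hι.aemeasurable _)).ne'
    rw [Set.preimage_range, measure_univ]
    exact one_pos
  · rw [Measure.map_apply hι ht.measurableSet, Real.coe_toNNReal _ hd.le]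
    rcases eq_or_ne (Metric.ediam t) 0 with hzero | hzero
    · rw [hν.measure_preimage_eq_zero hX.toIsSubshift hh hzero]
      exact zero_le
    have htop := ne_top_of_le_ne_top ENNReal.ofReal_ne_top hdiam
    have hD := ENNReal.toReal_pos hzero htop
    rw [← ENNReal.ofReal_toReal htop, ENNReal.ofReal_rpow_of_pos hD,
      ← ENNReal.ofReal_mul (by positivity)]
    exact hν.measure_preimage_le_mul_rpow hX.toIsSubshift hn hD
      (ENNReal.toReal_le_of_le_ofReal (by positivity) hdiam) (ENNReal.ofReal_toReal htop).symm

theorem dim_eq (hX : X.HasBoundedGaps N) :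
    X.dim = ENNReal.ofReal (2 * X.entropy / Real.log n) := by
  rcases Nat.lt_or_ge n 2 with hn | hn
  · obtain rfl : n = 1 := by
      have := hX.alphabet_pos
      omega
    rw [dim_eq_dimH_range, dimH_subsingleton]
    · simp
    · exact fun x _ y _ => funext fun i => Subsingleton.elim (α := Fin 1) _ _
  · exact le_antisymm (hX.dim_le hn) (hX.le_dim hn)

end HasBoundedGaps

end ShiftSpace

/-! ### Factor maps -/

namespace ShiftSpace

variable {m N : ℕ} {X : ShiftSpace m}

/-- The sequence that carries `y` on `{a, …, b}` and `x` elsewhere. -/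
def splice (x y : ℤ → Fin m) (a b : ℤ) : ℤ → Fin m :=
  fun i => if a ≤ i ∧ i ≤ b then y i else x i

theorem splice_of_mem {x y : ℤ → Fin m} {a b i : ℤ} (ha : a ≤ i) (hb : i ≤ b) :
    splice x y a b i = y i :=
  if_pos ⟨ha, hb⟩

theorem splice_of_notMem {x y : ℤ → Fin m} {a b i : ℤ} (h : i < a ∨ b < i) :
    splice x y a b i = x i :=
  if_neg (by omega)

/-- A shift space is one-step if blocks of points that agree at both ends can be exchanged. -/
def IsOneStep (X : ShiftSpace m) : Prop :=
  ∀ x ∈ X.carrier, ∀ y ∈ X.carrier, ∀ a b : ℤ, x a = y a → x b = y b →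
    splice x y a b ∈ X.carrier

theorem HasBoundedGaps.exists_infinite_occurrences (hX : X.HasBoundedGaps N) (k : ℕ) (x : X.Pt) :
    ∃ z : X.Pt, {t : ℕ | ∀ i : ℤ, 0 ≤ i → i < k → z.1 (i + t) = x.1 i}.Infinite := by
  obtain ⟨ν, c, C, hν⟩ := hX.exists_isGibbs
  have hpos : (ν : Measure X.Pt) (X.cylinder (X.headWord k x)) ≠ 0 := fun h => by
    have := (mul_pos hν.pos (Real.exp_pos _)).trans_le (hν.le_measure k x)
    simp [measureReal_def, h] at this
  have recurrent := hν.measurePreserving.conservative.ae_mem_imp_frequently_image_mem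
    (X.isClopen_cylinder (X.headWord k x)).isOpen.measurableSet.nullMeasurableSet
  obtain ⟨z, hz, hrec⟩ := ((frequently_ae_mem_iff.2 hpos).and_eventually recurrent).exists
  refine ⟨z, ?_⟩
  simpa only [mem_cylinder_headWord, shiftMap_iterate_apply] using
    Nat.frequently_atTop_iff_infinite.1 (hrec hz)

end ShiftSpace

namespace FactorMap

open ShiftSpace

variable {m n N r : ℕ} {X : ShiftSpace m} {Y : ShiftSpace n}

theorem iterate_apply (f : FactorMap X Y) (x : X.Pt) (t : ℕ) (i : ℤ) :
    (f.toFun (X.shiftMap^[t] x)).1 i = (f.toFun x).1 (i + t) := by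
  rw [(f.semiconj.iterate_right t).eq, shiftMap_iterate_apply]

theorem translate_apply (f : FactorMap X Y) (hX : X.IsSubshift) (t : ℤ) (x : X.Pt) (i : ℤ) :
    (f.toFun (hX.translate t x)).1 i = (f.toFun x).1 (i + t) := by
  obtain ⟨s, rfl | rfl⟩ := t.eq_nat_or_neg
  · have : hX.translate s x = X.shiftMap^[s] x :=
      Subtype.ext (funext fun i => by rw [shiftMap_iterate_apply, IsSubshift.translate_apply])
    rw [this, iterate_apply]
  · have : x = X.shiftMap^[s] (hX.translate (-s) x) :=
      Subtype.ext (funext fun i => by rw [shiftMap_iterate_apply]; simp)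
    conv_rhs => rw [this, iterate_apply]
    simp

/-- `f` is a sliding block code of radius `r`: the image at a coordinate only depends on the
coordinates at distance at most `r`. -/
def HasRadius (f : FactorMap X Y) (r : ℕ) : Prop :=
  ∀ (i : ℤ) (x y : X.Pt), (∀ j, i - r ≤ j → j ≤ i + r → x.1 j = y.1 j) →
    (f.toFun x).1 i = (f.toFun y).1 i

theorem exists_radius_zero (f : FactorMap X Y) (hX : X.IsSubshift) : ∃ r : ℕ, ∀ x y : X.Pt,
    (∀ j : ℤ, -r ≤ j → j ≤ r → x.1 j = y.1 j) → (f.toFun x).1 0 = (f.toFun y).1 0 := by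
  by_contra! hcon
  choose x y hxy hne using hcon
  have := hX.compactSpace
  have hU : (hyperfilter ℕ : Filter ℕ) ≤ atTop := Nat.hyperfilter_le_atTop
  obtain ⟨a, hxa⟩ : ∃ a, Tendsto x (hyperfilter ℕ) (𝓝 a) :=
    ⟨_, ((hyperfilter ℕ).map x).le_nhds_lim⟩
  have hya : Tendsto y (hyperfilter ℕ) (𝓝 a) := by
    refine tendsto_subtype_rng.2 (tendsto_pi_nhds.2 fun i => ?_)
    refine (tendsto_pi_nhds.1 (tendsto_subtype_rng.1 hxa) i).congr' ?_
    filter_upwards [hU (eventually_gt_atTop i.natAbs)] with r (hr : i.natAbs < r)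
    exact hxy r i (by omega) (by omega)
  have hf : Tendsto (fun z => (f.toFun z).1 0) (𝓝 a) (pure ((f.toFun a).1 0)) := by
    rw [← nhds_discrete]
    exact ((ShiftSpace.continuous_apply 0).comp f.continuous_toFun).tendsto a
  obtain ⟨r, hxr, hyr⟩ :=
    ((tendsto_pure.1 (hf.comp hxa)).and (tendsto_pure.1 (hf.comp hya))).exists
  exact hne r (hxr.trans hyr.symm)

/-- The Curtis–Hedlund–Lyndon theorem. -/
theorem exists_hasRadius (f : FactorMap X Y) (hX : X.IsSubshift) : ∃ r, f.HasRadius r := by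
  obtain ⟨r, hr⟩ := f.exists_radius_zero hX
  refine ⟨r, fun i x y h => ?_⟩
  have := hr (hX.translate i x) (hX.translate i y) fun j h₁ h₂ => h _ (by linarith) (by linarith)
  simpa [translate_apply] using this

theorem carrier_eq_range (f : FactorMap X Y) : Y.carrier = Set.range fun x => (f.toFun x).1 := by
  refine Set.Subset.antisymm (fun y hy => ?_) (by rintro _ ⟨x, rfl⟩; exact (f.toFun x).2)
  obtain ⟨x, hx⟩ := f.surjective_toFun ⟨y, hy⟩
  exact ⟨x, congrArg Subtype.val hx⟩

theorem isSubshift (f : FactorMap X Y) (hX : X.IsSubshift) : Y.IsSubshift where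
  isClosed := by
    have := hX.compactSpace
    rw [f.carrier_eq_range]
    exact (isCompact_range (continuous_subtype_val.comp f.continuous_toFun)).isClosed
  nonempty := by
    have := hX.nonempty_pt
    rw [f.carrier_eq_range]
    exact Set.range_nonempty _
  translate_mem y hy t := by
    rw [f.carrier_eq_range] at hy ⊢
    obtain ⟨x, rfl⟩ := hy
    exact ⟨hX.translate t x, funext fun i => f.translate_apply hX t x i⟩

theorem HasRadius.hasBoundedGaps {f : FactorMap X Y} (hr : f.HasRadius r)
    (hX : X.HasBoundedGaps N) : Y.HasBoundedGaps (N + 2 * r) := by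
  refine ⟨f.isSubshift hX.toIsSubshift, fun y hy y' hy' => ?_⟩
  rw [f.carrier_eq_range] at hy hy'
  obtain ⟨x, rfl⟩ := hy
  obtain ⟨x', rfl⟩ := hy'
  -- The image of a glued point follows the image of each part only at distance `r` from the gap.
  obtain ⟨g, z, hzx, hzx'⟩ := hX.glue_at x (hX.translate (-r) x') r
  refine ⟨g + 2 * r, by omega, (f.toFun z).1, (f.toFun z).2, fun i hi => ?_, fun i hi => ?_⟩
  · exact hr i z x fun j _ hj => hzx j (by omega)
  · have hz := hr (i + (g + 2 * r : ℕ)) z (hX.translate (-(g + 2 * r : ℕ)) x') fun j hj _ => by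
      have := hzx' (j - r - g) (by push_cast at hj; omega)
      rw [IsSubshift.translate_apply, show (r : ℤ) + g + (j - r - g) = j by ring] at this
      rw [this, IsSubshift.translate_apply]
      push_cast
      ring_nf
    rw [hz, translate_apply, add_neg_cancel_right]

theorem exists_hasBoundedGaps (f : FactorMap X Y) (hX : X.HasBoundedGaps N) :
    ∃ M, Y.HasBoundedGaps M := by
  obtain ⟨r, hr⟩ := f.exists_hasRadius hX.toIsSubshift
  exact ⟨_, hr.hasBoundedGaps hX⟩

theorem HasRadius.ncard_words_le {f : FactorMap X Y} (hr : f.HasRadius r) (hX : X.IsSubshift)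
    (k : ℕ) : (Y.words k).ncard ≤ (X.words (k + 2 * r)).ncard := by
  have hY := f.isSubshift hX
  choose x hx using fun w : Y.words k => f.surjective_toFun (hY.point w)
  simp only [← Nat.card_coe_set_eq]
  refine Nat.card_le_card_of_injective (fun w : Y.words k =>
    (⟨_, hX.headWord_mem (k + 2 * r) (hX.translate (-r) (x w))⟩ : X.words (k + 2 * r))) ?_
  intro v w h
  simp only [Subtype.mk.injEq, headWord_eq_iff, IsSubshift.translate_apply] at h
  refine hY.ext_point fun i h0 hi => ?_
  rw [← hx v, ← hx w]
  refine hr i _ _ fun j h₁ h₂ => ?_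
  simpa using h (j + r) (by omega) (by push_cast; omega)

theorem entropy_le (f : FactorMap X Y) (hX : X.IsSubshift) : Y.entropy ≤ X.entropy := by
  have hY := f.isSubshift hX
  obtain ⟨r, hr⟩ := f.exists_hasRadius hX
  have hlim : Tendsto (fun k : ℕ => Real.log (X.words k).ncard / k +
      Real.log (X.words (2 * r)).ncard / k) atTop (𝓝 (X.entropy + 0)) :=
    hX.tendsto_entropy.add (tendsto_const_div_atTop_nhds_zero_nat _)
  rw [add_zero] at hlim
  refine le_of_tendsto_of_tendsto' hY.tendsto_entropy hlim fun k => ?_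
  have hpos : (0 : ℝ) < (Y.words k).ncard := by exact_mod_cast hY.ncard_words_pos k
  rw [← add_div]
  gcongr
  calc Real.log (Y.words k).ncard ≤ Real.log (X.words (k + 2 * r)).ncard :=
        Real.log_le_log hpos (by exact_mod_cast hr.ncard_words_le hX k)
    _ ≤ _ := hX.subadditive_log_ncard_words k (2 * r)

theorem measurePreserving_push (f : FactorMap X Y) {μ : ProbabilityMeasure X.Pt}
    (hμ : MeasurePreserving X.shiftMap (μ : Measure X.Pt) (μ : Measure X.Pt)) :
    MeasurePreserving Y.shiftMap (f.push μ : Measure Y.Pt) (f.push μ : Measure Y.Pt) := by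
  have hf := f.continuous_toFun.measurable
  have hσ := Y.continuous_shiftMap.measurable
  refine ⟨hσ, ?_⟩
  change ((μ : Measure X.Pt).map f.toFun).map Y.shiftMap = (μ : Measure X.Pt).map f.toFun
  rw [Measure.map_map hσ hf, ← f.semiconj.comp_eq,
    ← Measure.map_map hf X.continuous_shiftMap.measurable, hμ.map_eq]

theorem HasRadius.map_eq_of_splice {f : FactorMap X Y} (hr : f.HasRadius r) {z y s : X.Pt}
    {a b : ℤ} (hs : s.1 = splice z.1 y.1 a b)
    (hl : ∀ j, a ≤ j → j ≤ a + 2 * r → z.1 j = y.1 j)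
    (hrt : ∀ j, b - 2 * r ≤ j → j ≤ b → z.1 j = y.1 j)
    (hf : ∀ j, a + r ≤ j → j ≤ b - r → (f.toFun z).1 j = (f.toFun y).1 j) :
    f.toFun s = f.toFun z := by
  have hout : ∀ j, j ≤ a + 2 * r ∨ b - 2 * r ≤ j → s.1 j = z.1 j := fun j hj => by
    by_cases hin : a ≤ j ∧ j ≤ b
    · rw [hs, splice_of_mem hin.1 hin.2]
      exact (hj.elim (hl j hin.1) fun h => hrt j h hin.2).symm
    · rw [hs, splice_of_notMem (by omega)]
  refine Subtype.ext (funext fun j => ?_)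
  rcases le_or_gt j (a + r) with hja | hja
  · exact hr j _ _ fun l _ h => hout l (Or.inl (by omega))
  rcases le_or_gt (b - r) j with hjb | hjb
  · exact hr j _ _ fun l h _ => hout l (Or.inr (by omega))
  · rw [hf j hja.le hjb.le]
    refine hr j _ _ fun l h₁ h₂ => ?_
    rw [hs, splice_of_mem (by omega) (by omega)]

theorem HasRadius.exists_exchange {f : FactorMap X Y} (hr : f.HasRadius r) (hX : X.IsSubshift)
    (hstep : X.IsOneStep) {k : ℕ} (hk : 2 * r < k) {x y : X.Pt}
    (hl : ∀ i : ℤ, 0 ≤ i → i ≤ 2 * r → x.1 i = y.1 i)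
    (hrt : ∀ i : ℤ, k - 1 - 2 * r ≤ i → i < k → x.1 i = y.1 i)
    (hfxy : ∀ i : ℤ, 0 ≤ i → i < k → (f.toFun x).1 i = (f.toFun y).1 i)
    {z : X.Pt} {t : ℤ} (hz : ∀ i : ℤ, 0 ≤ i → i < k → z.1 (i + t) = x.1 i) :
    ∃ s : X.Pt, f.toFun s = f.toFun z ∧ (∀ i : ℤ, 0 ≤ i → i < k → s.1 (i + t) = y.1 i) ∧
      ∀ j < t, s.1 j = z.1 j := by
  have hzx : ∀ j : ℤ, t ≤ j → j < t + k → z.1 j = (hX.translate (-t) x).1 j :=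
    fun j h₁ h₂ => by simpa [sub_eq_add_neg] using hz (j - t) (by omega) (by omega)
  have hleft : ∀ j : ℤ, t ≤ j → j ≤ t + 2 * r → z.1 j = (hX.translate (-t) y).1 j :=
    fun j h₁ h₂ => (hzx j h₁ (by omega)).trans (hl _ (by omega) (by omega))
  have hright : ∀ j : ℤ, t + k - 1 - 2 * r ≤ j → j ≤ t + k - 1 →
      z.1 j = (hX.translate (-t) y).1 j :=
    fun j h₁ h₂ => (hzx j (by omega) (by omega)).trans (hrt _ (by omega) (by omega))
  have hs := hstep z.1 z.2 _ (hX.translate (-t) y).2 t (t + k - 1) (hleft t le_rfl (by omega))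
    (hright _ (by omega) le_rfl)
  refine ⟨⟨_, hs⟩, hr.map_eq_of_splice rfl hleft hright fun j h₁ h₂ => ?_, fun i h0 hi => ?_,
    fun j hj => splice_of_notMem (Or.inl hj)⟩
  · rw [hr j z (hX.translate (-t) x) fun l h₃ h₄ => hzx l (by omega) (by omega),
      translate_apply, translate_apply]
    exact hfxy _ (by omega) (by omega)
  · refine (splice_of_mem (by omega) (by omega)).trans ?_
    rw [IsSubshift.translate_apply, add_neg_cancel_right]

/-- A finite-to-one factor map of a one-step shift space has no diamonds: exchanging `x` for `y`
at infinitely many occurrences of `x` would give infinitely many points with the same image. -/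
theorem FiniteToOne.eq_of_map_eq {f : FactorMap X Y} (hf : f.FiniteToOne)
    (hX : X.HasBoundedGaps N) (hstep : X.IsOneStep) (hr : f.HasRadius r) {k : ℕ} {x y : X.Pt}
    (hl : ∀ i : ℤ, 0 ≤ i → i ≤ 2 * r → x.1 i = y.1 i)
    (hrt : ∀ i : ℤ, k - 1 - 2 * r ≤ i → i < k → x.1 i = y.1 i)
    (hfxy : ∀ i : ℤ, 0 ≤ i → i < k → (f.toFun x).1 i = (f.toFun y).1 i) {i : ℤ}
    (h0 : 0 ≤ i) (hi : i < k) : x.1 i = y.1 i := by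
  by_contra hne
  have hk : 2 * r < k := not_le.1 fun hk => hne (hl i h0 (by omega))
  obtain ⟨z, hz⟩ := hX.exists_infinite_occurrences k x
  choose s hsz hsy hs using fun t : {t : ℕ | ∀ i : ℤ, 0 ≤ i → i < k → z.1 (i + t) = x.1 i} =>
    hr.exists_exchange hX.toIsSubshift hstep hk hl hrt hfxy t.2
  have := hz.to_subtype
  have : Finite (f.toFun ⁻¹' {f.toFun z}) := hf _
  obtain ⟨w, hw⟩ := Finite.exists_infinite_fiber
    fun t => (⟨s t, hsz t⟩ : f.toFun ⁻¹' {f.toFun z})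
  rw [Set.infinite_coe_iff] at hw
  obtain ⟨t, ht⟩ := hw.nonempty
  obtain ⟨_, ⟨t', ht', rfl⟩, hlt⟩ := (hw.image Subtype.val_injective.injOn).exists_gt ((t : ℕ) + k)
  have heq : s t = s t' := congrArg Subtype.val (ht.trans ht'.symm)
  have hti : (t : ℤ) + i < (t' : ℕ) := by omega
  refine hne ?_
  rw [← t.2 i h0 hi, ← hsy t i h0 hi, heq, add_comm]
  exact (hs t' _ hti).symm

theorem FiniteToOne.ncard_headWord_image_le {f : FactorMap X Y} (hf : f.FiniteToOne)
    (hX : X.HasBoundedGaps N) (hstep : X.IsOneStep) (hr : f.HasRadius r) (k : ℕ)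
    (v : Fin k → Fin n) : (X.headWord k '' (Y.headWord k ∘ f.toFun ⁻¹' {v})).ncard ≤
      m ^ (2 * r + 1) * m ^ (2 * r + 1) := by
  choose x hx hxu using fun u : ↥(X.headWord k '' (Y.headWord k ∘ f.toFun ⁻¹' {v})) => u.2
  have hcard : m ^ (2 * r + 1) * m ^ (2 * r + 1) =
      Nat.card ((Fin (2 * r + 1) → Fin m) × (Fin (2 * r + 1) → Fin m)) := by simp
  rw [← Nat.card_coe_set_eq, hcard]
  refine Nat.card_le_card_of_injective (fun u => (X.headWord (2 * r + 1) (x u),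
    X.headWord (2 * r + 1) (hX.translate (k - 1 - 2 * r) (x u)))) fun u w h => Subtype.ext ?_
  simp only [Prod.mk.injEq, headWord_eq_iff, IsSubshift.translate_apply] at h
  rw [← hxu u, ← hxu w, headWord_eq_iff]
  intro i h0 hi
  refine hf.eq_of_map_eq hX hstep hr (k := k) (fun j h₁ h₂ => ?_) (fun j h₁ h₂ => ?_)
    (headWord_eq_iff.1 ((hx u).trans (hx w).symm)) h0 hi
  · exact h.1 j h₁ (by push_cast; omega)
  · simpa using h.2 (j - (k - 1 - 2 * r)) (by omega) (by push_cast; omega)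

theorem FiniteToOne.measureEntropy_le {f : FactorMap X Y} (hf : f.FiniteToOne)
    (hX : X.HasBoundedGaps N) (hstep : X.IsOneStep) {μ : ProbabilityMeasure X.Pt}
    (hμ : MeasurePreserving X.shiftMap (μ : Measure X.Pt) (μ : Measure X.Pt)) :
    X.measureEntropy μ ≤ Y.measureEntropy (f.push μ) := by
  obtain ⟨r, hr⟩ := f.exists_hasRadius hX.toIsSubshift
  have hlim : Tendsto (fun k : ℕ => shannonEntropy (f.push μ : Measure Y.Pt) (Y.headWord k) / k +
      Real.log ↑(m ^ (2 * r + 1) * m ^ (2 * r + 1)) / k) atTop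
      (𝓝 (Y.measureEntropy (f.push μ) + 0)) :=
    (tendsto_measureEntropy (f.measurePreserving_push hμ)).add
      (tendsto_const_div_atTop_nhds_zero_nat _)
  rw [add_zero] at hlim
  refine le_of_tendsto_of_tendsto' (tendsto_measureEntropy hμ) hlim fun k => ?_
  have hfm := f.continuous_toFun.measurable
  have hpush : shannonEntropy (f.push μ : Measure Y.Pt) (Y.headWord k) =
      shannonEntropy (μ : Measure X.Pt) (Y.headWord k ∘ f.toFun) :=
    shannonEntropy_map _ hfm (Y.measurable_headWord k)
  rw [← add_div, hpush]
  gcongr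
  exact shannonEntropy_le_add_log (X.measurable_headWord k) ((Y.measurable_headWord k).comp hfm)
    (hf.ncard_headWord_image_le hX hstep hr k)

theorem FiniteToOne.push_mem_maxMeasures {f : FactorMap X Y} (hf : f.FiniteToOne)
    (hX : X.HasBoundedGaps N) (hstep : X.IsOneStep) {μ : ProbabilityMeasure X.Pt}
    (hμ : μ ∈ X.maxMeasures) : f.push μ ∈ Y.maxMeasures := by
  have hinv := f.measurePreserving_push hμ.1
  refine ⟨hinv, le_antisymm ((f.isSubshift hX.toIsSubshift).measureEntropy_le hinv) ?_⟩
  calc Y.entropy ≤ X.entropy := f.entropy_le hX.toIsSubshift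
    _ = X.measureEntropy μ := hμ.2.symm
    _ ≤ Y.measureEntropy (f.push μ) := hf.measureEntropy_le hX hstep hμ.1

end FactorMap

/-! ### Topological Markov chains -/

section Markov

theorem exists_walk_of_pow_pos {V R : Type*} [Fintype V] [DecidableEq V] [Semiring R]
    [LinearOrder R] [IsStrictOrderedRing R] {T : Matrix V V R} (hT : ∀ a b, 0 ≤ T a b) {k : ℕ}
    {a b : V} (h : 0 < (T ^ k) a b) :
    ∃ p : ℤ → V, p 0 = a ∧ p k = b ∧ ∀ i : ℤ, 0 ≤ i → i < k → 0 < T (p i) (p (i + 1)) := by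
  induction k generalizing b with
  | zero =>
    have hab : a = b := by
      by_contra hab
      simp [hab] at h
    exact ⟨fun _ => a, rfl, hab, fun i h0 hi => absurd hi (by simpa using h0)⟩
  | succ k ih =>
    rw [pow_succ, Matrix.mul_apply] at h
    obtain ⟨c, -, hc⟩ := Finset.exists_lt_of_sum_lt (s := Finset.univ) (f := fun _ => (0 : R))
      (by simpa using h)
    have hac : 0 < (T ^ k) a c := pos_of_mul_pos_left hc (hT c b)
    have hcb : 0 < T c b := pos_of_mul_pos_right hc hac.le
    obtain ⟨p, hp0, hpk, hp⟩ := ih hac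
    refine ⟨fun i => if i ≤ k then p i else b, by simpa using hp0, by simp, fun i h0 hi => ?_⟩
    rcases (show i ≤ k by omega).lt_or_eq with hik | rfl
    · simpa [hik.le, Int.add_one_le_iff.2 hik] using hp i h0 hik
    · simpa [hpk] using hcb

variable {m : ℕ} {T : Matrix (Fin m) (Fin m) ℝ}

theorem isClosed_markovChain (T : Matrix (Fin m) (Fin m) ℝ) :
    IsClosed (markovChain T).carrier := by
  have hT : Continuous fun z : Fin m × Fin m => T z.1 z.2 := continuous_of_discreteTopology
  simp only [markovChain, Set.ofPred_forall]
  exact isClosed_iInter fun i =>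
    isClosed_eq (hT.comp₂ (continuous_apply i) (continuous_apply (i + 1))) continuous_const

theorem isOneStep_markovChain (T : Matrix (Fin m) (Fin m) ℝ) : (markovChain T).IsOneStep := by
  intro x hx y hy a b ha hb i
  have hxi : T (x i) (x (i + 1)) = 1 := hx i
  have hyi : T (y i) (y (i + 1)) = 1 := hy i
  unfold ShiftSpace.splice
  split_ifs with h h' h'
  · exact hyi
  · obtain rfl : i = b := by omega
    rwa [← hb]
  · obtain rfl : i + 1 = a := by omega
    rwa [← ha]
  · exact hxi

theorem mem_markovChain_of_closed_walk {k : ℕ} (hk : 0 < k) {p : ℤ → Fin m} (hpk : p k = p 0)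
    (hp : ∀ i : ℤ, 0 ≤ i → i < k → T (p i) (p (i + 1)) = 1) :
    (fun i => p (i % k)) ∈ (markovChain T).carrier := by
  intro i
  have hk' : (0 : ℤ) < k := by exact_mod_cast hk
  have h0 := Int.emod_nonneg i hk'.ne'
  have hlt := Int.emod_lt_of_pos i hk'
  have hstep := hp (i % k) h0 hlt
  have hwrap : p ((i + 1) % k) = p (i % k + 1) := by
    rw [← Int.emod_add_emod]
    rcases (show i % k + 1 ≤ k from hlt).lt_or_eq with h | h
    · rw [Int.emod_eq_of_lt (by omega) h]
    · rw [h, Int.emod_self, hpk]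
  simpa only [hwrap] using hstep

theorem markovChain_glue {x y : ℤ → Fin m} (hx : x ∈ (markovChain T).carrier)
    (hy : y ∈ (markovChain T).carrier) {g : ℕ} {p : ℤ → Fin m} (hpx : p 0 = x (-1))
    (hpy : p (g + 1) = y 0) (hp : ∀ i : ℤ, 0 ≤ i → i < g + 1 → T (p i) (p (i + 1)) = 1) :
    ∃ z ∈ (markovChain T).carrier, (∀ i < 0, z i = x i) ∧ ∀ i : ℤ, 0 ≤ i → z (i + g) = y i := by
  let z : ℤ → Fin m := fun i => if i < 0 then x i else if i < g then p (i + 1) else y (i - g)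
  have hzx : ∀ i < 0, z i = x i := fun i hi => if_pos hi
  have hzy : ∀ i : ℤ, g ≤ i → z i = y (i - g) := fun i hi =>
    (if_neg (by omega)).trans (if_neg (by omega))
  have hzp : ∀ i : ℤ, -1 ≤ i → i ≤ g → z i = p (i + 1) := by
    intro i hi hig
    rcases hi.eq_or_lt with rfl | hi
    · rw [hzx _ (by norm_num), neg_add_cancel, hpx]
    rcases hig.eq_or_lt with rfl | hig
    · rw [hzy _ le_rfl, sub_self, hpy]
    · exact (if_neg (by omega)).trans (if_pos hig)
  refine ⟨z, fun i => ?_, hzx, fun i hi => by rw [hzy _ (by omega), add_sub_cancel_right]⟩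
  rcases lt_or_ge i (-1) with h | h
  · rw [hzx i (by omega), hzx (i + 1) (by omega)]
    exact hx i
  rcases lt_or_ge i g with h' | h'
  · rw [hzp i h h'.le, hzp (i + 1) (by omega) h']
    exact hp _ (by omega) (by omega)
  · rw [hzy i h', hzy (i + 1) (by omega), add_sub_right_comm]
    exact hy _

theorem exists_markovChain_hasBoundedGaps (hm : 0 < m) (hT : ∀ a b, T a b = 0 ∨ T a b = 1)
    (hirr : T.IsIrreducible) : ∃ N, (markovChain T).HasBoundedGaps N := by
  choose k hk hpos using (Matrix.isIrreducible_iff_exists_pow_pos hirr.nonneg).1 hirr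
  have hwalk : ∀ a b, ∃ p : ℤ → Fin m, p 0 = a ∧ p (k a b) = b ∧
      ∀ i : ℤ, 0 ≤ i → i < k a b → T (p i) (p (i + 1)) = 1 := fun a b => by
    obtain ⟨p, hpa, hpb, hp⟩ := exists_walk_of_pow_pos hirr.nonneg (hpos a b)
    exact ⟨p, hpa, hpb, fun i h0 hi => (hT _ _).resolve_left (hp i h0 hi).ne'⟩
  refine ⟨Finset.univ.sup fun z : Fin m × Fin m => k z.1 z.2,
    ⟨isClosed_markovChain T, ?_, fun x hx t i => ?_⟩, fun x hx y hy => ?_⟩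
  · obtain ⟨p, hp0, hpk, hp⟩ := hwalk ⟨0, hm⟩ ⟨0, hm⟩
    exact ⟨_, mem_markovChain_of_closed_walk (hk _ _) (hpk.trans hp0.symm) hp⟩
  · have := hx (i + t)
    rwa [add_right_comm] at this
  · obtain ⟨p, hpx, hpy, hp⟩ := hwalk (x (-1)) (y 0)
    have hle : k (x (-1)) (y 0) ≤ Finset.univ.sup fun z : Fin m × Fin m => k z.1 z.2 :=
      Finset.le_sup (f := fun z : Fin m × Fin m => k z.1 z.2) (Finset.mem_univ (x (-1), y 0))
    obtain ⟨g, hg⟩ := Nat.exists_eq_add_of_lt (hk (x (-1)) (y 0))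
    rw [zero_add] at hg
    rw [hg] at hpy hp hle
    push_cast at hpy hp
    exact ⟨g, by omega, markovChain_glue hx hy hpx hpy hp⟩

end Markov

/-! ### The dimension formula -/

namespace ShiftSpace.HasBoundedGaps

variable {m n M N : ℕ} {X : ShiftSpace m} {Y : ShiftSpace n}

theorem dimFormula_of_dimFormula (hX : X.HasBoundedGaps N) (hY : Y.HasBoundedGaps M)
    (hle : Y.entropy ≤ X.entropy) {μ : ProbabilityMeasure X.Pt} (hμ : μ ∈ X.maxMeasures)
    {ν : ProbabilityMeasure Y.Pt} (hν : ν ∈ Y.maxMeasures) {κ : ℝ} (hκ : 0 < κ)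
    (h : X.DimFormula κ μ) : Y.DimFormula κ ν := by
  rw [DimFormula, hX.dim_eq, hμ.2] at h
  rw [DimFormula, hY.dim_eq, hν.2]
  rcases hX.entropy_nonneg.eq_or_lt with h0 | hpos
  · have hY0 : Y.entropy = 0 := le_antisymm (hle.trans h0.ge) hY.entropy_nonneg
    rw [hY0, mul_zero, mul_zero]
  · have hlog : 0 < Real.log m := hpos.trans_le hX.entropy_le_log
    rw [ENNReal.ofReal_eq_ofReal_iff (by positivity) (by positivity),
      div_left_inj' hlog.ne', mul_left_inj' hpos.ne'] at h
    rw [h]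

theorem exists_maxMeasures_eq (hX : X.HasBoundedGaps N) : ∃ ν, X.maxMeasures = {ν} := by
  obtain ⟨ν, c, C, hν⟩ := hX.exists_isGibbs
  exact ⟨ν, hν.maxMeasures_eq hX⟩

end ShiftSpace.HasBoundedGaps

theorem mainTheorem2_general {m₁ m₂ n₁ n₂ N₁ N₂ : ℕ} {X₁ : ShiftSpace m₁} {X₂ : ShiftSpace m₂}
    {Y₁ : ShiftSpace n₁} {Y₂ : ShiftSpace n₂} (hX₁ : X₁.HasBoundedGaps N₁)
    (hX₂ : X₂.HasBoundedGaps N₂) (hstep₁ : X₁.IsOneStep) (hstep₂ : X₂.IsOneStep)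
    (φ₁ : FactorMap X₁ Y₁) (φ₂ : FactorMap X₂ Y₂) (hφ₁ : φ₁.FiniteToOne) (hφ₂ : φ₂.FiniteToOne) :
    (∀ π : FactorMap X₁ X₂, π.IsUniform → ∀ μ ∈ X₁.maxMeasures, ∀ μ' ∈ X₂.maxMeasures,
      ∀ κ : ℝ, 0 < κ → X₁.DimFormula κ μ → X₂.DimFormula κ μ' ∧ X₂.DimFormula κ (π.push μ)) ∧
    (Y₂.entropy ≤ Y₁.entropy →
      ∃ πbar : Y₁.maxMeasures → Y₂.maxMeasures,
        Continuous πbar ∧ Function.Surjective πbar ∧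
        (∀ π : FactorMap X₁ X₂, π.IsUniform → ∀ μ ∈ X₁.maxMeasures,
          ∃ h : φ₁.push μ ∈ Y₁.maxMeasures, (πbar ⟨φ₁.push μ, h⟩).1 = φ₂.push (π.push μ)) ∧
        ∀ (ν : Y₁.maxMeasures) (κ : ℝ), 0 < κ →
          Y₁.DimFormula κ ν.1 → Y₂.DimFormula κ (πbar ν).1) := by
  obtain ⟨M₁, hY₁⟩ := φ₁.exists_hasBoundedGaps hX₁
  obtain ⟨M₂, hY₂⟩ := φ₂.exists_hasBoundedGaps hX₂
  refine ⟨fun π hπ μ hμ μ' hμ' κ hκ h => ?_, fun hle => ?_⟩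
  · have dimFormula : ∀ ν ∈ X₂.maxMeasures, X₂.DimFormula κ ν := fun ν hν =>
      hX₁.dimFormula_of_dimFormula hX₂ (π.entropy_le hX₁.toIsSubshift) hμ hν hκ h
    exact ⟨dimFormula μ' hμ', dimFormula _ (hπ μ hμ)⟩
  · obtain ⟨ν₁, hν₁⟩ := hY₁.exists_maxMeasures_eq
    obtain ⟨ν₂, hν₂⟩ := hY₂.exists_maxMeasures_eq
    have hmem₁ : ν₁ ∈ Y₁.maxMeasures := hν₁ ▸ rfl
    have hmem₂ : ν₂ ∈ Y₂.maxMeasures := hν₂ ▸ rfl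
    have unique : ∀ ν ∈ Y₂.maxMeasures, ν₂ = ν := fun ν hν => (hν₂.subset hν).symm
    exact ⟨fun _ => ⟨ν₂, hmem₂⟩, continuous_const,
      fun ν => ⟨⟨ν₁, hmem₁⟩, Subtype.ext (unique ν.1 ν.2)⟩,
      fun π hπ μ hμ => ⟨hφ₁.push_mem_maxMeasures hX₁ hstep₁ hμ,
        unique _ (hφ₂.push_mem_maxMeasures hX₂ hstep₂ (hπ μ hμ))⟩,
      fun ν κ hκ h => hY₁.dimFormula_of_dimFormula hY₂ hle ν.2 hmem₂ hκ h⟩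

theorem mainTheorem2 (d : ℕ) (B : Set (Fin 2 → Fin (2 * d + 1) → Fin 2))
    (m : Fin 2 → ℕ) (hm : ∀ l, 0 < m l)
    (T : ∀ l, Matrix (Fin (m l)) (Fin (m l)) ℝ)
    (hT : ∀ l a b, T l a b = 0 ∨ T l a b = 1)
    (hirr : ∀ l, (T l).IsIrreducible)
    (φ : ∀ l, FactorMap (markovChain (T l)) (layerSpace d B l))
    (hφ : ∀ l, (φ l).FiniteToOne)
    (hne : (layerSpace d B 0).entropy ≠ (layerSpace d B 1).entropy)
    (i j : Fin 2) (hij : i ≠ j) :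
    (∀ π : FactorMap (markovChain (T i)) (markovChain (T j)), π.IsUniform →
      ∀ μ ∈ (markovChain (T i)).maxMeasures, ∀ μ' ∈ (markovChain (T j)).maxMeasures,
      ∀ κ : ℝ, 0 < κ → (markovChain (T i)).DimFormula κ μ →
        (markovChain (T j)).DimFormula κ μ' ∧ (markovChain (T j)).DimFormula κ (π.push μ)) ∧
    ((layerSpace d B j).entropy < (layerSpace d B i).entropy →
      (φ i).HasSynchronizingWord →
      ∃ πbar : (layerSpace d B i).maxMeasures → (layerSpace d B j).maxMeasures,
        Continuous πbar ∧ Function.Surjective πbar ∧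
        (∀ π : FactorMap (markovChain (T i)) (markovChain (T j)), π.IsUniform →
          ∀ μ ∈ (markovChain (T i)).maxMeasures,
          ∃ h : (φ i).push μ ∈ (layerSpace d B i).maxMeasures,
            (πbar ⟨(φ i).push μ, h⟩).1 = (φ j).push (π.push μ)) ∧
        ∀ (ν : (layerSpace d B i).maxMeasures) (κ : ℝ), 0 < κ →
          (layerSpace d B i).DimFormula κ ν.1 →
          (layerSpace d B j).DimFormula κ (πbar ν).1) := by
  choose N hW using fun l => exists_markovChain_hasBoundedGaps (hm l) (hT l) (hirr l)
  have general := mainTheorem2_general (hW i) (hW j) (isOneStep_markovChain (T i))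
    (isOneStep_markovChain (T j)) (φ i) (φ j) (hφ i) (hφ j)
  exact ⟨general.1, fun hlt _ => general.2 hlt.le⟩
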